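/- Let $R$ and $S$ be associative rings with unit; modules are left modules unless said otherwise, and right $R$-modules are identified with $R^{op}$-modules. Let $n\ge 1$ and $k\ge 0$ be integers. A module $L$ is finitely $n$-presented if there is an exact sequence $F_n\to\cdots\to F_1\to F_0\to L\to 0$ with all $F_i$ finitely generated free. An $S$-module $X$ is $fp_n$-injective if for every injection $K\to L$ of finitely $n$-presented $S$-modules the map $\operatorname{Hom}_S(L,X)\to\operatorname{Hom}_S(K,X)$ is surjective. An $R$-module $Y$ is $fp_n$-flat if for every injection $K\to L$ of finitely $n$-presented right $R$-modules the map $K\otimes_R Y\to L\otimes_R Y$ is injective. An $(S,R)$-bimodule $C={}_SC_R$ is semidualizing if ${}_SC$ and $C_R$ each admit a projective resolution by finitely generated projective modules, the homothety maps $S\to\operatorname{Hom}_{R^{op}}(C,C)$ and $R\to\operatorname{Hom}_S(C,C)$ are isomorphisms, and $\operatorname{Ext}^i_S(C,C)=0=\operatorname{Ext}^i_{R^{op}}(C,C)$ for all $i\ge 1$. It is faithfully semidualizing if, moreover, for every left $S$-module $N$ and every right $R$-module $M$, $\operatorname{Hom}_S(C,N)=0$ implies $N=0$, and $\operatorname{Hom}_{R^{op}}(C,M)=0$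 implies $M=0$. The Auslander class $\mathcal A_C(R)$ consists of the $R$-modules $M$ such that $\operatorname{Tor}^R_i(C,M)=0=\operatorname{Ext}^i_S(C,C\otimes_R M)$ for all $i\ge 1$ and the map $M\to\operatorname{Hom}_S(C,C\otimes_R M)$, $m\mapsto(c\mapsto c\otimes m)$, is an isomorphism. The Bass class $\mathcal B_C(S)$ consists of the $S$-modules $N$ such that $\operatorname{Ext}^i_S(C,N)=0=\operatorname{Tor}^R_i(C,\operatorname{Hom}_S(C,N))$ for all $i\ge 1$ and the evaluation map $C\otimes_R\operatorname{Hom}_S(C,N)\to N$ is an isomorphism. An $R$-module is $C$-$fp_n$-injective if it is isomorphic to $\operatorname{Hom}_S(C,X)$ for some $fp_n$-injective $S$-module $X$; an $S$-module is $C$-$fp_n$-flat if it is isomorphic to $C\otimes_R Y$ for some $fp_n$-flat $R$-module $Y$. A module $M$ has ($C$-)$fp_n$-injective dimension $\le k$ if there is an exact sequence $0\to M\to I_0\to\cdots\to I_k\to 0$ with all $I_i$ ($C$-)$fp_n$-injective; a module $N$ has ($C$-)$fp_n$-flat dimension $\le k$ if there is an exact sequence $0\to F_k\to\cdots\to F_0\to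 N\to 0$ with all $F_i$ ($C$-)$fp_n$-flat. Let $C={}_SC_R$ be a faithfully semidualizing bimodule, $M$ an $R$-module and $N$ an $S$-module. Then: (i) $M$ has $C$-$fp_n$-injective dimension $\le k$ if and only if $M\in\mathcal A_C(R)$ and the $S$-module $C\otimes_R M$ has $fp_n$-injective dimension $\le k$. (ii) $N$ has $C$-$fp_n$-flat dimension $\le k$ if and only if $N\in\mathcal B_C(S)$ and the $R$-module $\operatorname{Hom}_S(C,N)$ has $fp_n$-flat dimension $\le k$. -/

import Mathlib

open CategoryTheory TensorProduct MulOpposite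

universe u

noncomputable section

namespace SemiDual

/-! Rings are associative with unit and need not be commutative.  "Module" means left module; a right
`R`-module is a module over `Rᵐᵒᵖ`, the element `k r` being `op r • k`.  An `(S, R)`-bimodule is an
abelian group `C` with `[Module S C] [Module Rᵐᵒᵖ C] [SMulCommClass S Rᵐᵒᵖ C]`. -/

/-! ### The tensor product `K ⊗_R M` of a right and a left module over a ring -/

section Tensor

variable (R : Type u) [Ring R]

/-- The subgroup of `K ⊗_ℤ M` generated by the elements `k r ⊗ m - k ⊗ r m`. -/
def balancedRel (K M : Type u) [AddCommGroup K] [Module Rᵐᵒᵖ K] [AddCommGroup M] [Module R M] :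
    AddSubgroup (K ⊗[ℤ] M) :=
  AddSubgroup.closure
    {x | ∃ (k : K) (r : R) (m : M), x = (op r • k) ⊗ₜ[ℤ] m - k ⊗ₜ[ℤ] (r • m)}

/-- The tensor product `K ⊗_R M` of a right `R`-module `K` and a left `R`-module `M`. -/
def Tens (K M : Type u) [AddCommGroup K] [Module Rᵐᵒᵖ K] [AddCommGroup M] [Module R M] : Type u :=
  (K ⊗[ℤ] M) ⧸ balancedRel R K M

variable {K K' K'' M M' M'' : Type u}
  [AddCommGroup K] [Module Rᵐᵒᵖ K] [AddCommGroup M] [Module R M]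
  [AddCommGroup K'] [Module Rᵐᵒᵖ K'] [AddCommGroup M'] [Module R M']
  [AddCommGroup K''] [Module Rᵐᵒᵖ K''] [AddCommGroup M''] [Module R M'']

instance : AddCommGroup (Tens R K M) :=
  inferInstanceAs (AddCommGroup ((K ⊗[ℤ] M) ⧸ balancedRel R K M))

/-- The pure tensor `k ⊗ m` in `K ⊗_R M`. -/
def tmul (k : K) (m : M) : Tens R K M :=
  QuotientAddGroup.mk' (balancedRel R K M) (k ⊗ₜ[ℤ] m)

theorem tmul_add (k : K) (m m' : M) : tmul R k (m + m') = tmul R k m + tmul R k m' := by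
  rw [tmul, TensorProduct.tmul_add, map_add]; rfl

theorem add_tmul (k k' : K) (m : M) : tmul R (k + k') m = tmul R k m + tmul R k' m := by
  rw [tmul, TensorProduct.add_tmul, map_add]; rfl

theorem smul_tmul (r : R) (k : K) (m : M) : tmul R (op r • k) m = tmul R k (r • m) := by
  refine (QuotientAddGroup.eq_iff_sub_mem).2 ?_
  exact AddSubgroup.subset_closure ⟨k, r, m, rfl⟩

/-- Two additive maps out of `K ⊗_R M` that agree on pure tensors are equal. -/
theorem Tens.hom_ext {A : Type*} [AddCommGroup A] {f g : Tens R K M →+ A}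
    (h : ∀ k m, f (tmul R k m) = g (tmul R k m)) : f = g := by
  refine QuotientAddGroup.addMonoidHom_ext (balancedRel R K M) ?_
  ext x
  induction x using TensorProduct.induction_on with
  | zero => simp
  | tmul k m => exact h k m
  | add x y hx hy => rw [map_add, map_add, hx, hy]

/-- The universal property: an `R`-balanced biadditive map induces an additive map on `K ⊗_R M`. -/
def Tens.lift {A : Type*} [AddCommGroup A] (b : K →+ M →+ A)
    (hb : ∀ (r : R) (k : K) (m : M), b (op r • k) m = b k (r • m)) : Tens R K M →+ A :=
  QuotientAddGroup.lift (balancedRel R K M)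
    (TensorProduct.liftAddHom b fun z k m => by simp) (by
      rw [balancedRel, AddSubgroup.closure_le]
      rintro _ ⟨k, r, m, rfl⟩
      simp [hb])

@[simp] theorem Tens.lift_tmul {A : Type*} [AddCommGroup A] (b : K →+ M →+ A)
    (hb : ∀ (r : R) (k : K) (m : M), b (op r • k) m = b k (r • m)) (k : K) (m : M) :
    Tens.lift R b hb (tmul R k m) = b k m := rfl

/-- The map `f ⊗ g : K ⊗_R M → K' ⊗_R M'`. -/
def Tens.map (f : K →ₗ[Rᵐᵒᵖ] K') (g : M →ₗ[R] M') : Tens R K M →+ Tens R K' M' :=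
  Tens.lift R
    { toFun := fun k =>
        { toFun := fun m => tmul R (f k) (g m)
          map_zero' := by rw [map_zero]; simpa using tmul_add R (f k) (0 : M') 0
          map_add' := fun m m' => by rw [map_add, tmul_add] }
      map_zero' := by
        ext m
        simpa using add_tmul R (0 : K') 0 (g m)
      map_add' := fun k k' => by
        ext m
        simp [add_tmul] }
    (fun r k m => by simp [smul_tmul])

@[simp] theorem Tens.map_tmul (f : K →ₗ[Rᵐᵒᵖ] K') (g : M →ₗ[R] M') (k : K) (m : M) :
    Tens.map R f g (tmul R k m) = tmul R (f k) (g m) := rfl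

theorem Tens.map_id :
    Tens.map R (LinearMap.id : K →ₗ[Rᵐᵒᵖ] K) (LinearMap.id : M →ₗ[R] M) = AddMonoidHom.id _ :=
  Tens.hom_ext R fun _ _ => rfl

theorem Tens.map_comp (f : K →ₗ[Rᵐᵒᵖ] K') (f' : K' →ₗ[Rᵐᵒᵖ] K'') (g : M →ₗ[R] M')
    (g' : M' →ₗ[R] M'') :
    Tens.map R (f' ∘ₗ f) (g' ∘ₗ g) = (Tens.map R f' g').comp (Tens.map R f g) :=
  Tens.hom_ext R fun _ _ => rfl

theorem Tens.map_add_left (f f' : K →ₗ[Rᵐᵒᵖ] K') (g : M →ₗ[R] M') :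
    Tens.map R (f + f') g = Tens.map R f g + Tens.map R f' g :=
  Tens.hom_ext R fun k m => add_tmul R (f k) (f' k) (g m)

/-- If `C` is an `(S, R)`-bimodule then `C ⊗_R M` is an `S`-module via `s (c ⊗ m) = (s c) ⊗ m`. -/
instance Tens.instModule (S : Type u) [Ring S] [Module S K] [SMulCommClass S Rᵐᵒᵖ K] :
    Module S (Tens R K M) where
  smul s x := Tens.map R (Module.toModuleEnd Rᵐᵒᵖ (S := S) K s) LinearMap.id x
  one_smul x := DFunLike.congr_fun (f := Tens.map R (Module.toModuleEnd Rᵐᵒᵖ (S := S) K 1)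
    LinearMap.id) (g := AddMonoidHom.id _) (by rw [map_one]; exact Tens.map_id R) x
  mul_smul s t x := DFunLike.congr_fun (f := Tens.map R (Module.toModuleEnd Rᵐᵒᵖ (S := S) K (s * t))
    LinearMap.id) (g := (Tens.map R (Module.toModuleEnd Rᵐᵒᵖ (S := S) K s) LinearMap.id).comp
      (Tens.map R (Module.toModuleEnd Rᵐᵒᵖ (S := S) K t) LinearMap.id))
    (by rw [map_mul, ← Tens.map_comp]; rfl) x
  smul_zero s := map_zero _
  smul_add s := map_add _
  add_smul s t x := DFunLike.congr_fun (f := Tens.map R (Module.toModuleEnd Rᵐᵒᵖ (S := S) K (s + t))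
    LinearMap.id) (g := Tens.map R (Module.toModuleEnd Rᵐᵒᵖ (S := S) K s) LinearMap.id +
      Tens.map R (Module.toModuleEnd Rᵐᵒᵖ (S := S) K t) LinearMap.id)
    (by rw [map_add]; exact Tens.map_add_left R _ _ _) x
  zero_smul x := DFunLike.congr_fun (f := Tens.map R (Module.toModuleEnd Rᵐᵒᵖ (S := S) K 0)
    LinearMap.id) (g := 0) (by
      rw [map_zero]
      exact Tens.hom_ext R fun k m => by simpa using add_tmul R (0 : K) 0 m) x

theorem Tens.smul_tmul' {S : Type u} [Ring S] [Module S K] [SMulCommClass S Rᵐᵒᵖ K]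
    (s : S) (k : K) (m : M) : s • tmul R k m = tmul R (s • k) m := rfl

/-- The functor `- ⊗_R M` from right `R`-modules to abelian groups. -/
def tensFunctor (M : ModuleCat.{u} R) : ModuleCat.{u} Rᵐᵒᵖ ⥤ AddCommGrpCat.{u} where
  obj K := AddCommGrpCat.of (Tens R K M)
  map f := AddCommGrpCat.ofHom (Tens.map R f.hom LinearMap.id)
  map_id K := by
    rw [ModuleCat.hom_id, Tens.map_id]; rfl
  map_comp f g := by
    rw [ModuleCat.hom_comp, ← AddCommGrpCat.ofHom_comp, ← Tens.map_comp, LinearMap.id_comp]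

instance (M : ModuleCat.{u} R) : (tensFunctor R M).Additive where
  map_add {_ _ f g} := by
    simp only [tensFunctor, ModuleCat.hom_add, Tens.map_add_left]; rfl

/-- `Tor_i^R(K, M)`: the value at `K` of the `i`-th left derived functor of `- ⊗_R M`. -/
def TorGrp (i : ℕ) (K : ModuleCat.{u} Rᵐᵒᵖ) (M : ModuleCat.{u} R) : AddCommGrpCat.{u} :=
  ((tensFunctor R M).leftDerived i).obj K

end Tensor

/-! ### `Hom_S(C, N)` as a left `R`-module -/

section Hom

/-- `Hom_S(C, N)`.  For an `(S, R)`-bimodule `C` it carries the left `R`-module structure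
`(r f)(c) = f (c r)`. -/
def HomMod (S : Type u) [Ring S] (C N : Type u) [AddCommGroup C] [Module S C]
    [AddCommGroup N] [Module S N] : Type u :=
  C →ₗ[S] N

variable (R S : Type u) [Ring R] [Ring S] (C N : Type u)
  [AddCommGroup C] [Module S C] [Module Rᵐᵒᵖ C] [SMulCommClass S Rᵐᵒᵖ C]
  [AddCommGroup N] [Module S N]

instance : AddCommGroup (HomMod S C N) := inferInstanceAs (AddCommGroup (C →ₗ[S] N))

instance : FunLike (HomMod S C N) C N := inferInstanceAs (FunLike (C →ₗ[S] N) C N)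

/-- Right multiplication `c ↦ c r` on an `(S, R)`-bimodule, as an `S`-linear map. -/
def rightMul (r : R) : C →ₗ[S] C where
  toFun c := op r • c
  map_add' := smul_add (op r)
  map_smul' s c := (smul_comm s (op r) c).symm

instance HomMod.instModule : Module R (HomMod S C N) where
  smul r f := (f : C →ₗ[S] N) ∘ₗ rightMul R S C r
  one_smul f := LinearMap.ext fun c => congrArg f (one_smul Rᵐᵒᵖ c)
  mul_smul r r' f := LinearMap.ext fun c => congrArg f (mul_smul (op r') (op r) c)
  smul_zero _ := rfl
  smul_add _ _ _ := rfl
  add_smul r r' f := LinearMap.ext fun c =>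
    (congrArg f (add_smul (op r) (op r') c)).trans (LinearMap.map_add (f : C →ₗ[S] N) _ _)
  zero_smul f := LinearMap.ext fun c =>
    (congrArg f (zero_smul Rᵐᵒᵖ c)).trans (LinearMap.map_zero (f : C →ₗ[S] N))

theorem HomMod.smul_apply (r : R) (f : HomMod S C N) (c : C) : (r • f) c = f (op r • c) := rfl

end Hom

/-! ### Resolutions, finitely `n`-presented, `fp_n`-injective and `fp_n`-flat modules -/

section Classes

variable {R : Type u} [Ring R]

/-- The sequence `⋯ → F₂ → F₁ → F₀ → M → 0` is exact. -/
structure IsLeftResolution {M : ModuleCat.{u} R} (F : ℕ → ModuleCat.{u} R)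
    (d : ∀ i, F (i + 1) →ₗ[R] F i) (ε : F 0 →ₗ[R] M) : Prop where
  surjective : Function.Surjective ε
  exact_zero : Function.Exact (d 0) ε
  exact_succ : ∀ i, Function.Exact (d (i + 1)) (d i)

/-- The sequence `0 → M → I₀ → I₁ → I₂ → ⋯` is exact. -/
structure IsRightResolution {M : ModuleCat.{u} R} (I : ℕ → ModuleCat.{u} R)
    (d : ∀ i, I i →ₗ[R] I (i + 1)) (η : M →ₗ[R] I 0) : Prop where
  injective : Function.Injective η
  exact_zero : Function.Exact η (d 0)
  exact_succ : ∀ i, Function.Exact (d i) (d (i + 1))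

/-- `M` admits a projective resolution by finitely generated projective modules. -/
def HasDegreewiseFiniteResolution (M : ModuleCat.{u} R) : Prop :=
  ∃ (P : ℕ → ModuleCat.{u} R) (d : ∀ i, P (i + 1) →ₗ[R] P i) (ε : P 0 →ₗ[R] M),
    IsLeftResolution P d ε ∧ ∀ i, Module.Projective R (P i) ∧ Module.Finite R (P i)

/-- `M` is finitely `n`-presented: there is an exact sequence `Fₙ → ⋯ → F₁ → F₀ → M → 0` with all
`Fᵢ` finitely generated free.  (Terms and maps of index beyond `n` are irrelevant.) -/
def IsFinitelyNPresented (n : ℕ) (M : ModuleCat.{u} R) : Prop :=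
  ∃ (F : ℕ → ModuleCat.{u} R) (d : ∀ i, F (i + 1) →ₗ[R] F i) (ε : F 0 →ₗ[R] M),
    (∀ i ≤ n, Module.Free R (F i) ∧ Module.Finite R (F i)) ∧
    Function.Surjective ε ∧
    (1 ≤ n → Function.Exact (d 0) ε) ∧
    (∀ i, i + 2 ≤ n → Function.Exact (d (i + 1)) (d i))

/-- The class `fp_nI(R)`: every map `K → M` extends along every injection `K → L` of
finitely `n`-presented modules. -/
def fpInj (n : ℕ) : ObjectProperty (ModuleCat.{u} R) := fun M =>
  ∀ K L : ModuleCat.{u} R, IsFinitelyNPresented n K → IsFinitelyNPresented n L →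
    ∀ f : K →ₗ[R] L, Function.Injective f →
      Function.Surjective (fun h : L →ₗ[R] M => h ∘ₗ f)

/-- The class `fp_nF(R)`: `K ⊗_R M → L ⊗_R M` is injective for every injection `K → L` of
finitely `n`-presented right `R`-modules. -/
def fpFlat (n : ℕ) : ObjectProperty (ModuleCat.{u} R) := fun M =>
  ∀ K L : ModuleCat.{u} Rᵐᵒᵖ, IsFinitelyNPresented n K → IsFinitelyNPresented n L →
    ∀ f : K →ₗ[Rᵐᵒᵖ] L, Function.Injective f →
      Function.Injective (Tens.map R f (LinearMap.id : M →ₗ[R] M))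

/-- There is an exact sequence `0 → M → I₀ → ⋯ → I_k → 0` with all `Iᵢ` in the class `P`.
(The sequence is continued by zero modules.) -/
def CoresDimLE (P : ObjectProperty (ModuleCat.{u} R)) (k : ℕ) (M : ModuleCat.{u} R) : Prop :=
  ∃ (I : ℕ → ModuleCat.{u} R) (d : ∀ i, I i →ₗ[R] I (i + 1)) (η : M →ₗ[R] I 0),
    IsRightResolution I d η ∧ (∀ i ≤ k, P (I i)) ∧ ∀ i, k < i → Subsingleton (I i)

/-- There is an exact sequence `0 → F_k → ⋯ → F₀ → M → 0` with all `Fᵢ` in the class `P`.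
(The sequence is continued by zero modules.) -/
def ResDimLE (P : ObjectProperty (ModuleCat.{u} R)) (k : ℕ) (M : ModuleCat.{u} R) : Prop :=
  ∃ (F : ℕ → ModuleCat.{u} R) (d : ∀ i, F (i + 1) →ₗ[R] F i) (ε : F 0 →ₗ[R] M),
    IsLeftResolution F d ε ∧ (∀ i ≤ k, P (F i)) ∧ ∀ i, k < i → Subsingleton (F i)

end Classes

/-! ### Semidualizing bimodules, Auslander and Bass classes -/

section Bimodule

variable (R S : Type u) [Ring R] [Ring S] (C : Type u)
  [AddCommGroup C] [Module S C] [Module Rᵐᵒᵖ C] [SMulCommClass S Rᵐᵒᵖ C]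

/-- The `S`-module `C ⊗_R M`. -/
abbrev tensObj (M : ModuleCat.{u} R) : ModuleCat.{u} S := ModuleCat.of S (Tens R C M)

/-- The `R`-module `Hom_S(C, N)`. -/
abbrev homObj (N : ModuleCat.{u} S) : ModuleCat.{u} R := ModuleCat.of R (HomMod S C N)

/-- The `(S, R)`-bimodule `C` is semidualizing. -/
structure IsSemidualizing : Prop where
  resolution_left : HasDegreewiseFiniteResolution (ModuleCat.of S C)
  resolution_right : HasDegreewiseFiniteResolution (ModuleCat.of Rᵐᵒᵖ C)
  /-- The homothety map `S → Hom_{Rᵒᵖ}(C, C)`, `s ↦ (c ↦ s c)`, is bijective. -/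
  homothety_left : Function.Bijective (Module.toModuleEnd Rᵐᵒᵖ (S := S) C)
  /-- The homothety map `R → Hom_S(C, C)`, `r ↦ (c ↦ c r)`, is bijective. -/
  homothety_right : Function.Bijective (rightMul R S C)
  ext_left : ∀ i : ℕ, 1 ≤ i →
    Subsingleton (Abelian.Ext.{u} (ModuleCat.of S C) (ModuleCat.of S C) i)
  ext_right : ∀ i : ℕ, 1 ≤ i →
    Subsingleton (Abelian.Ext.{u} (ModuleCat.of Rᵐᵒᵖ C) (ModuleCat.of Rᵐᵒᵖ C) i)

/-- The `(S, R)`-bimodule `C` is faithfully semidualizing. -/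
structure IsFaithfullySemidualizing : Prop extends IsSemidualizing R S C where
  faithful_left : ∀ N : ModuleCat.{u} S, Subsingleton (C →ₗ[S] N) → Subsingleton N
  faithful_right : ∀ M : ModuleCat.{u} Rᵐᵒᵖ, Subsingleton (C →ₗ[Rᵐᵒᵖ] M) → Subsingleton M

/-- The evaluation map `μ_M : M → Hom_S(C, C ⊗_R M)`, `m ↦ (c ↦ c ⊗ m)`. -/
def evalMu (M : ModuleCat.{u} R) : M →ₗ[R] homObj R S C (tensObj R S C M) where
  toFun m :=
    ({ toFun := fun c => tmul R c m
       map_add' := fun c c' => add_tmul R c c' m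
       map_smul' := fun _ _ => rfl } : C →ₗ[S] Tens R C M)
  map_add' m m' := LinearMap.ext fun c => tmul_add R c m m'
  map_smul' r m := LinearMap.ext fun c => (smul_tmul R r c m).symm

/-- The evaluation map `ν_N : C ⊗_R Hom_S(C, N) → N`, `c ⊗ f ↦ f c`. -/
def evalNu (N : ModuleCat.{u} S) : tensObj R S C (homObj R S C N) →ₗ[S] N :=
  let ev : Tens R C (HomMod S C N) →+ N := Tens.lift R
    { toFun := fun c =>
        { toFun := fun f => f c
          map_zero' := rfl
          map_add' := fun _ _ => rfl }
      map_zero' := AddMonoidHom.ext fun f => LinearMap.map_zero (f : C →ₗ[S] N)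
      map_add' := fun c c' => AddMonoidHom.ext fun f => LinearMap.map_add (f : C →ₗ[S] N) c c' }
    (fun _ _ _ => rfl)
  { toFun := ev
    map_add' := map_add ev
    map_smul' := fun s x => DFunLike.congr_fun
      (f := ev.comp (DistribSMul.toAddMonoidHom (Tens R C (HomMod S C N)) s))
      (g := (DistribSMul.toAddMonoidHom N s).comp ev)
      (Tens.hom_ext R fun c f => LinearMap.map_smul (f : C →ₗ[S] N) s c) x }

/-- The Auslander class `A_C(R)`. -/
structure auslanderClass (M : ModuleCat.{u} R) : Prop where
  tor_zero : ∀ i : ℕ, 1 ≤ i → Limits.IsZero (TorGrp R i (ModuleCat.of Rᵐᵒᵖ C) M)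
  ext_zero : ∀ i : ℕ, 1 ≤ i → Subsingleton (Abelian.Ext.{u} (ModuleCat.of S C) (tensObj R S C M) i)
  bijective : Function.Bijective (evalMu R S C M)

/-- The Bass class `B_C(S)`. -/
structure bassClass (N : ModuleCat.{u} S) : Prop where
  ext_zero : ∀ i : ℕ, 1 ≤ i → Subsingleton (Abelian.Ext.{u} (ModuleCat.of S C) N i)
  tor_zero : ∀ i : ℕ, 1 ≤ i →
    Limits.IsZero (TorGrp R i (ModuleCat.of Rᵐᵒᵖ C) (homObj R S C N))
  bijective : Function.Bijective (evalNu R S C N)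

/-- The class `Cfp_nI(R)` of the `R`-modules of the form `Hom_S(C, X)`, `X` in `fp_nI(S)`. -/
def CfpInj (n : ℕ) : ObjectProperty (ModuleCat.{u} R) := fun M =>
  ∃ X : ModuleCat.{u} S, fpInj n X ∧ Nonempty (M ≃ₗ[R] homObj R S C X)

/-- The class `Cfp_nF(S)` of the `S`-modules of the form `C ⊗_R Y`, `Y` in `fp_nF(R)`. -/
def CfpFlat (n : ℕ) : ObjectProperty (ModuleCat.{u} S) := fun N =>
  ∃ Y : ModuleCat.{u} R, fpFlat n Y ∧ Nonempty (N ≃ₗ[S] tensObj R S C Y)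

end Bimodule

end SemiDual

end

noncomputable section

namespace SemiDual

/-! ### Ext and Tor as exactness of explicit complexes -/

section Resolution

variable {R : Type u} [Ring R]

/-! The functors `Hom_S(C, -)` and `C ⊗_R -` are mutually inverse between the Bass and Auslander
classes (`auslanderClass_homObj`, `bassClass_tensObj`), so the work lies in getting modules into
these classes.

The decisive point is that `fp_n`-injective modules lie in the Bass class and `fp_n`-flat modules in
the Auslander class (`bassClass_of_fpInj`, `auslanderClass_of_fpFlat`). Take a resolution `P` of `C`
over `Rᵐᵒᵖ` by finitely generated projectives and apply `Hom(-, C)`. The homothety isomorphism and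
the vanishing of `Ext(C, C)` give an exact sequence `0 → S → Hom(P₀, C) → Hom(P₁, C) → ⋯`. Its terms
are retracts of powers of `C`, so all cosyzygies are finitely `n`-presented, and `Hom_S(-, X)` keeps
the sequence exact when `X` is `fp_n`-injective. Since `Hom_S(Hom(Pᵢ, C), X) ≅ Pᵢ ⊗ Hom_S(C, X)`,
the result is the complex `P ⊗ Hom_S(C, X)` augmented to `X`: its exactness is the Tor vanishing
together with bijectivity of `ν`. The flat case resolves `C` over `S` and tensors the dual sequence
with `Y`.

Dimension `k` then follows by induction along short exact sequences. The Auslander class is closed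
under kernels of epimorphisms and the Bass class under cokernels of monomorphisms, and the same Ext
and Tor vanishing keeps the short sequences exact under both functors. For the converse, Ext or Tor
vanishing against `C` passes to the successive (co)syzygies, so the functor carries the whole
(co)resolution across, and `μ` or `ν` identifies the module it resolves. -/

theorem IsLeftResolution.d_comp_d {M : ModuleCat.{u} R} {P : ℕ → ModuleCat.{u} R}
    {d : ∀ i, P (i + 1) →ₗ[R] P i} {ε : P 0 →ₗ[R] M} (h : IsLeftResolution P d ε) (i : ℕ) :
    ModuleCat.ofHom (d (i + 1)) ≫ ModuleCat.ofHom (d i) = 0 := by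
  ext x
  exact (h.exact_succ i).apply_apply_eq_zero x

/-- The chain complex underlying a left resolution. -/
def IsLeftResolution.complex {M : ModuleCat.{u} R} {P : ℕ → ModuleCat.{u} R}
    {d : ∀ i, P (i + 1) →ₗ[R] P i} {ε : P 0 →ₗ[R] M} (h : IsLeftResolution P d ε) :
    ChainComplex (ModuleCat.{u} R) ℕ :=
  ChainComplex.of P (fun i => ModuleCat.ofHom (d i)) h.d_comp_d

theorem IsLeftResolution.complex_d {M : ModuleCat.{u} R} {P : ℕ → ModuleCat.{u} R}
    {d : ∀ i, P (i + 1) →ₗ[R] P i} {ε : P 0 →ₗ[R] M} (h : IsLeftResolution P d ε) (i : ℕ) :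
    h.complex.d (i + 1) i = ModuleCat.ofHom (d i) :=
  ChainComplex.of_d (X := P) (d := fun i => ModuleCat.ofHom (d i)) i

theorem IsLeftResolution.exactAt {M : ModuleCat.{u} R} {P : ℕ → ModuleCat.{u} R}
    {d : ∀ i, P (i + 1) →ₗ[R] P i} {ε : P 0 →ₗ[R] M} (h : IsLeftResolution P d ε) (n : ℕ) :
    h.complex.ExactAt (n + 1) := by
  rw [HomologicalComplex.exactAt_iff' _ (n + 1 + 1) (n + 1) n (by simp) (by simp)]
  rw [ShortComplex.moduleCat_exact_iff]
  intro x hx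
  change (h.complex.d (n + 1) n).hom x = 0 at hx
  change ∃ y, (h.complex.d (n + 1 + 1) (n + 1)).hom y = x
  rw [complex_d] at hx ⊢
  exact (h.exact_succ n x).1 hx

/-- The projective resolution given by a left resolution with projective terms. -/
def IsLeftResolution.projectiveResolution {M : ModuleCat.{u} R} {P : ℕ → ModuleCat.{u} R}
    {d : ∀ i, P (i + 1) →ₗ[R] P i} {ε : P 0 →ₗ[R] M} (h : IsLeftResolution P d ε)
    (hP : ∀ i, Module.Projective R (P i)) : ProjectiveResolution M where
  complex := h.complex
  projective n := (IsProjective.iff_projective (P n)).1 (hP n)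
  π := (ChainComplex.toSingle₀Equiv _ _).symm ⟨ModuleCat.ofHom ε, by
    rw [complex_d]; ext x; exact h.exact_zero.apply_apply_eq_zero x⟩
  quasiIso := ⟨fun n => by
    cases n
    -- In degree zero the claim is that `P 1 → P 0 → M` is exact with an epimorphism at the end.
    · rw [ChainComplex.quasiIsoAt₀_iff, ShortComplex.quasiIso_iff_of_zeros']
      · have hw : h.complex.d 1 0 ≫ ModuleCat.ofHom ε = 0 := by
          rw [complex_d]; ext x; exact h.exact_zero.apply_apply_eq_zero x
        refine (ShortComplex.exact_and_epi_g_iff_of_iso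
          (S₂ := ShortComplex.mk (h.complex.d 1 0) (ModuleCat.ofHom ε) hw) ?_).2 ⟨?_, ?_⟩
        · exact ShortComplex.isoMk (Iso.refl _) (Iso.refl _) (Iso.refl _)
            ((Category.id_comp _).trans (Category.comp_id _).symm)
            ((Category.id_comp _).trans (Category.comp_id _).symm)
        · rw [ShortComplex.moduleCat_exact_iff]
          intro x hx
          change ∃ y, (h.complex.d 1 0).hom y = x
          rw [complex_d]
          exact (h.exact_zero x).1 hx
        · exact (ModuleCat.epi_iff_surjective _).2 h.surjective
      all_goals rfl
    · rw [quasiIsoAt_iff_exactAt']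
      · exact h.exactAt _
      · apply ChainComplex.exactAt_succ_single_obj⟩

/-- The complex `Hom(P, N)` is exact in positive degrees. -/
def HomExact (P : ℕ → ModuleCat.{u} R) (d : ∀ i, P (i + 1) →ₗ[R] P i) (N : Type u)
    [AddCommGroup N] [Module R N] : Prop :=
  ∀ (i : ℕ) (f : P (i + 1) →ₗ[R] N), f ∘ₗ d (i + 1) = 0 → ∃ g : P i →ₗ[R] N, g ∘ₗ d i = f

/-- A class in `Ext^(i+1)` is represented by a cocycle on `P (i + 1)`, and is zero exactly when the
cocycle is a coboundary. One fixed resolution serves every `N`, which allows diagram chases in place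
of long exact sequences. -/
theorem IsLeftResolution.ext_iff {M : ModuleCat.{u} R} {P : ℕ → ModuleCat.{u} R}
    {d : ∀ i, P (i + 1) →ₗ[R] P i} {ε : P 0 →ₗ[R] M} (h : IsLeftResolution P d ε)
    (hP : ∀ i, Module.Projective R (P i)) (N : ModuleCat.{u} R) :
    (∀ i : ℕ, 1 ≤ i → Subsingleton (Abelian.Ext.{u} M N i)) ↔ HomExact P d N := by
  let Q := h.projectiveResolution hP
  have hd : ∀ i, Q.complex.d (i + 1) i = ModuleCat.ofHom (d i) := h.complex_d
  constructor
  · intro H i f hf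
    have hf' : Q.complex.d (i + 1 + 1) (i + 1) ≫ (ModuleCat.ofHom f : P (i + 1) ⟶ N) = 0 := by
      rw [hd]
      exact ModuleCat.hom_ext hf
    have := H (i + 1) (by omega)
    obtain ⟨g, hg⟩ := (Q.extMk_eq_zero_iff (Y := N) (ModuleCat.ofHom f) (i + 1 + 1) rfl hf' i
      rfl).1 (Subsingleton.elim _ _)
    rw [hd] at hg
    exact ⟨g.hom, congrArg ModuleCat.Hom.hom hg⟩
  · rintro H (_ | i) hi
    · omega
    refine subsingleton_of_forall_eq 0 fun α => ?_
    obtain ⟨f, hf, rfl⟩ := Q.extMk_surjective α (i + 1 + 1) rfl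
    rw [Q.extMk_eq_zero_iff _ _ _ _ i rfl]
    rw [hd] at hf
    obtain ⟨g, hg⟩ := H i f.hom (congrArg ModuleCat.Hom.hom hf)
    refine ⟨ModuleCat.ofHom g, ?_⟩
    rw [hd]
    exact ModuleCat.hom_ext hg

/-- The complex `Q ⊗ M` is exact in positive degrees. -/
def TensExact (Q : ℕ → ModuleCat.{u} Rᵐᵒᵖ) (d : ∀ i, Q (i + 1) →ₗ[Rᵐᵒᵖ] Q i) (M : Type u)
    [AddCommGroup M] [Module R M] : Prop :=
  ∀ i : ℕ, Function.Exact (Tens.map R (d (i + 1)) (LinearMap.id : M →ₗ[R] M))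
    (Tens.map R (d i) LinearMap.id)

/-- The left derived functor is the homology of `Q ⊗ M`, and in abelian groups its vanishing is
elementwise exactness. -/
theorem IsLeftResolution.tor_iff {C : ModuleCat.{u} Rᵐᵒᵖ} {Q : ℕ → ModuleCat.{u} Rᵐᵒᵖ}
    {d : ∀ i, Q (i + 1) →ₗ[Rᵐᵒᵖ] Q i} {ε : Q 0 →ₗ[Rᵐᵒᵖ] C} (h : IsLeftResolution Q d ε)
    (hQ : ∀ i, Module.Projective Rᵐᵒᵖ (Q i)) (M : ModuleCat.{u} R) :
    (∀ i : ℕ, 1 ≤ i → Limits.IsZero (TorGrp R i C M)) ↔ TensExact Q d M := by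
  let P := h.projectiveResolution hQ
  have hd : ∀ i, P.complex.d (i + 1) i = ModuleCat.ofHom (d i) := h.complex_d
  have key : ∀ i, Limits.IsZero (TorGrp R (i + 1) C M) ↔
      Function.Exact (Tens.map R (d (i + 1)) (LinearMap.id : M →ₗ[R] M))
        (Tens.map R (d i) LinearMap.id) := by
    intro i
    rw [TorGrp, (P.isoLeftDerivedObj (tensFunctor R M) (i + 1)).isZero_iff]
    refine (HomologicalComplex.exactAt_iff_isZero_homology
      (((tensFunctor R M).mapHomologicalComplex _).obj P.complex) (i + 1)).symm.trans ?_
    rw [HomologicalComplex.exactAt_iff' _ (i + 1 + 1) (i + 1) i (by simp) (by simp),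
      ShortComplex.ab_exact_iff_function_exact]
    change Function.Exact ((tensFunctor R M).map (P.complex.d (i + 1 + 1) (i + 1)))
      ((tensFunctor R M).map (P.complex.d (i + 1) i)) ↔ _
    rw [hd, hd]
    rfl
  constructor
  · exact fun H i => (key i).1 (H (i + 1) (by omega))
  · rintro H (_ | i) hi
    · omega
    · exact (key i).2 (H i)

end Resolution

/-! ### Right exactness of the balanced tensor product -/

section RightExact

variable {R : Type u} [Ring R] {K K' K'' M M' M'' : Type u}
  [AddCommGroup K] [Module Rᵐᵒᵖ K] [AddCommGroup M] [Module R M]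
  [AddCommGroup K'] [Module Rᵐᵒᵖ K'] [AddCommGroup M'] [Module R M']
  [AddCommGroup K''] [Module Rᵐᵒᵖ K''] [AddCommGroup M''] [Module R M'']

theorem Tens.induction {p : Tens R K M → Prop} (x : Tens R K M) (h0 : p 0)
    (ht : ∀ k m, p (tmul R k m)) (ha : ∀ x y, p x → p y → p (x + y)) : p x := by
  obtain ⟨t, rfl⟩ := QuotientAddGroup.mk'_surjective (balancedRel R K M) x
  induction t using TensorProduct.induction_on with
  | zero => rwa [map_zero]
  | tmul k m => exact ht k m
  | add x y hx hy => rw [map_add]; exact ha _ _ hx hy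

theorem tmul_sub (k : K) (m m' : M) : tmul R k (m - m') = tmul R k m - tmul R k m' :=
  eq_sub_of_add_eq (by rw [← tmul_add, sub_add_cancel])

theorem sub_tmul (k k' : K) (m : M) : tmul R (k - k') m = tmul R k m - tmul R k' m :=
  eq_sub_of_add_eq (by rw [← add_tmul, sub_add_cancel])

theorem tmul_zero (k : K) : tmul R k (0 : M) = 0 := by
  rw [← sub_self (0 : M), tmul_sub, sub_self]

theorem zero_tmul (m : M) : tmul R (0 : K) m = 0 := by
  rw [← sub_self (0 : K), sub_tmul, sub_self]

theorem sum_tmul {ι : Type*} (s : Finset ι) (k : ι → K) (m : M) :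
    tmul R (∑ i ∈ s, k i) m = ∑ i ∈ s, tmul R (k i) m :=
  map_sum (⟨⟨fun k => tmul R k m, zero_tmul m⟩, fun k k' => add_tmul R k k' m⟩ : K →+ Tens R K M)
    k s

theorem Tens.map_surjective {f : K →ₗ[Rᵐᵒᵖ] K'} {g : M →ₗ[R] M'} (hf : Function.Surjective f)
    (hg : Function.Surjective g) : Function.Surjective (Tens.map R f g) := by
  intro y
  induction y using Tens.induction with
  | h0 => exact ⟨0, map_zero _⟩
  | ht k m =>
    obtain ⟨k, rfl⟩ := hf k
    obtain ⟨m, rfl⟩ := hg m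
    exact ⟨tmul R k m, rfl⟩
  | ha x y hx hy =>
    obtain ⟨x, rfl⟩ := hx
    obtain ⟨y, rfl⟩ := hy
    exact ⟨x + y, map_add _ _ _⟩

/-- A set-theoretic section `s` of `g` becomes additive and balanced modulo the image `I` of `f ⊗
1`. It thus defines `σ` on `K'' ⊗ M` whose composite with `g ⊗ 1` is the projection modulo `I`, so
the kernel of `g ⊗ 1` lies in `I`. -/
theorem Tens.exact_left {f : K →ₗ[Rᵐᵒᵖ] K'} {g : K' →ₗ[Rᵐᵒᵖ] K''} (hfg : Function.Exact f g)
    (hg : Function.Surjective g) :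
    Function.Exact (Tens.map R f (LinearMap.id : M →ₗ[R] M)) (Tens.map R g LinearMap.id) := by
  let I := (Tens.map R f (LinearMap.id : M →ₗ[R] M)).range
  have key : ∀ k k' : K', g k = g k' → ∀ m : M,
      QuotientAddGroup.mk' I (tmul R k m) = QuotientAddGroup.mk' I (tmul R k' m) := by
    intro k k' h m
    obtain ⟨a, ha⟩ := (hfg (k - k')).1 (by rw [map_sub, h, sub_self])
    refine (QuotientAddGroup.eq_iff_sub_mem).2 ⟨tmul R a m, ?_⟩
    rw [Tens.map_tmul, ha, ← sub_tmul]; rfl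
  let s := Function.surjInv hg
  have hs : ∀ k, g (s k) = k := Function.surjInv_eq hg
  let σ : Tens R K'' M →+ Tens R K' M ⧸ I := Tens.lift R
    { toFun := fun k =>
        { toFun := fun m => QuotientAddGroup.mk' I (tmul R (s k) m)
          map_zero' := by rw [tmul_zero, map_zero]
          map_add' := fun m m' => by rw [tmul_add, map_add] }
      map_zero' := by
        ext m
        refine (key _ 0 (by rw [hs, map_zero]) m).trans ?_
        rw [zero_tmul, map_zero]; rfl
      map_add' := fun k k' => by
        ext m
        refine (key _ (s k + s k') (by rw [map_add, hs, hs, hs]) m).trans ?_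
        rw [add_tmul, map_add]; rfl }
    (fun r k m => by
      refine (key _ (op r • s k) (by rw [map_smul, hs, hs]) m).trans ?_
      rw [smul_tmul]; rfl)
  have hσ : σ.comp (Tens.map R g LinearMap.id) = QuotientAddGroup.mk' I :=
    Tens.hom_ext R fun k m => key _ _ (hs _) m
  intro y
  constructor
  · intro hy
    have : QuotientAddGroup.mk' I y = 0 := by
      rw [← hσ, AddMonoidHom.comp_apply, hy, map_zero]
    exact (QuotientAddGroup.eq_zero_iff y).1 this
  · rintro ⟨x, rfl⟩
    rw [← AddMonoidHom.comp_apply, ← Tens.map_comp, hfg.linearMap_comp_eq_zero]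
    induction x using Tens.induction with
    | h0 => exact map_zero _
    | ht k m => exact zero_tmul m
    | ha x y hx hy => rw [map_add, hx, hy, add_zero]

theorem Tens.exact_right {f : M →ₗ[R] M'} {g : M' →ₗ[R] M''} (hfg : Function.Exact f g)
    (hg : Function.Surjective g) :
    Function.Exact (Tens.map R (LinearMap.id : K →ₗ[Rᵐᵒᵖ] K) f) (Tens.map R LinearMap.id g) := by
  let I := (Tens.map R (LinearMap.id : K →ₗ[Rᵐᵒᵖ] K) f).range
  have key : ∀ m m' : M', g m = g m' → ∀ k : K,
      QuotientAddGroup.mk' I (tmul R k m) = QuotientAddGroup.mk' I (tmul R k m') := by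
    intro m m' h k
    obtain ⟨a, ha⟩ := (hfg (m - m')).1 (by rw [map_sub, h, sub_self])
    refine (QuotientAddGroup.eq_iff_sub_mem).2 ⟨tmul R k a, ?_⟩
    rw [Tens.map_tmul, ha, ← tmul_sub]; rfl
  let s := Function.surjInv hg
  have hs : ∀ k, g (s k) = k := Function.surjInv_eq hg
  let σ : Tens R K M'' →+ Tens R K M' ⧸ I := Tens.lift R
    { toFun := fun k =>
        { toFun := fun m => QuotientAddGroup.mk' I (tmul R k (s m))
          map_zero' := by
            refine (key _ 0 (by rw [hs, map_zero]) k).trans ?_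
            rw [tmul_zero, map_zero]
          map_add' := fun m m' => by
            refine (key _ (s m + s m') (by rw [map_add, hs, hs, hs]) k).trans ?_
            rw [tmul_add, map_add] }
      map_zero' := by
        ext m
        change QuotientAddGroup.mk' I (tmul R 0 (s m)) = 0
        rw [zero_tmul, map_zero]
      map_add' := fun k k' => by
        ext m
        change QuotientAddGroup.mk' I (tmul R (k + k') (s m)) = _
        rw [add_tmul, map_add]; rfl }
    (fun r k m => by
      refine Eq.trans ?_ (key (r • s m) _ (by rw [map_smul, hs, hs]) k)
      rw [← smul_tmul]; rfl)
  have hσ : σ.comp (Tens.map R LinearMap.id g) = QuotientAddGroup.mk' I :=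
    Tens.hom_ext R fun k m => key _ _ (hs _) k
  intro y
  constructor
  · intro hy
    have : QuotientAddGroup.mk' I y = 0 := by
      rw [← hσ, AddMonoidHom.comp_apply, hy, map_zero]
    exact (QuotientAddGroup.eq_zero_iff y).1 this
  · rintro ⟨x, rfl⟩
    rw [← AddMonoidHom.comp_apply, ← Tens.map_comp, hfg.linearMap_comp_eq_zero]
    induction x using Tens.induction with
    | h0 => exact map_zero _
    | ht k m => exact tmul_zero _
    | ha x y hx hy => rw [map_add, hx, hy, add_zero]

end RightExact

/-! ### Finitely generated projectives and evaluation isomorphisms -/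

section DualBasis

/-- Split a surjection from a finite free module: the `e i` are the images of the standard basis,
the `φ i` the coordinates of the splitting. -/
theorem exists_dualBasis (R : Type u) [Ring R] (P : Type u) [AddCommGroup P] [Module R P]
    [Module.Projective R P] [Module.Finite R P] :
    ∃ (n : ℕ) (e : Fin n → P) (φ : Fin n → P →ₗ[R] R), ∀ p, ∑ i, φ i p • e i = p := by
  obtain ⟨n, f, g, -, -, hfg⟩ := Module.Finite.exists_comp_eq_id_of_projective R P
  refine ⟨n, fun i => f (Pi.single i 1), fun i => LinearMap.proj i ∘ₗ g, fun p => ?_⟩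
  have h := LinearMap.congr_fun hfg p
  rw [LinearMap.comp_apply, ← LinearMap.sum_single_apply (fun _ => R) (g p), map_sum] at h
  refine Eq.trans (Finset.sum_congr rfl fun i _ => ?_) h
  rw [← map_smul, ← Pi.single_smul, smul_eq_mul, mul_one]
  rfl

variable {R : Type u} [Ring R]

/-- Tensoring with a finitely generated projective module preserves injections. -/
theorem Tens.map_injective_of_projective (Q : Type u) [AddCommGroup Q] [Module Rᵐᵒᵖ Q]
    [Module.Projective Rᵐᵒᵖ Q] [Module.Finite Rᵐᵒᵖ Q] {M M' : Type u} [AddCommGroup M]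
    [Module R M] [AddCommGroup M'] [Module R M'] {f : M →ₗ[R] M'} (hf : Function.Injective f) :
    Function.Injective (Tens.map R (LinearMap.id : Q →ₗ[Rᵐᵒᵖ] Q) f) := by
  obtain ⟨n, e, φ, hφ⟩ := exists_dualBasis Rᵐᵒᵖ Q
  -- `π N i` is `φ i ⊗ 1`. The dual basis recovers `x` from its coordinates in `M`, and `f` is
  -- injective on each of them.
  let π (N : Type u) [AddCommGroup N] [Module R N] (i : Fin n) : Tens R Q N →+ N := Tens.lift R
    { toFun := fun q => DistribSMul.toAddMonoidHom N (φ i q).unop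
      map_zero' := by ext; simp
      map_add' := fun q q' => by ext; simp [add_smul] }
    (fun r q m => by simp [mul_smul])
  rw [injective_iff_map_eq_zero]
  intro x hx
  have h1 : ∀ i, f (π M i x) = π M' i (Tens.map R LinearMap.id f x) := by
    intro i
    refine DFunLike.congr_fun (f := f.toAddMonoidHom.comp (π M i))
      (g := (π M' i).comp (Tens.map R LinearMap.id f)) (Tens.hom_ext R fun q m => ?_) x
    exact map_smul f _ _
  have h2 : ∑ i, tmul R (e i) (π M i x) = x := by
    let T : Tens R Q M →+ Tens R Q M := ∑ i, AddMonoidHom.comp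
      ⟨⟨fun m => tmul R (e i) m, tmul_zero _⟩, fun m m' => tmul_add R _ m m'⟩ (π M i)
    have hT : T = AddMonoidHom.id _ := Tens.hom_ext R fun q m => by
      rw [AddMonoidHom.finsetSum_apply]
      change ∑ i, tmul R (e i) ((φ i q).unop • m) = tmul R q m
      simp_rw [← smul_tmul, op_unop]
      rw [← sum_tmul, hφ]
    have := DFunLike.congr_fun hT x
    rwa [AddMonoidHom.finsetSum_apply] at this
  rw [← h2]
  refine Finset.sum_eq_zero fun i _ => ?_
  have : π M i x = 0 := hf (by rw [h1, hx, map_zero, map_zero])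
  rw [this, tmul_zero]

variable {S : Type u} [Ring S] {C : Type u} [AddCommGroup C] [Module S C] [Module Rᵐᵒᵖ C]
  [SMulCommClass S Rᵐᵒᵖ C]

/-- The map `P ⊗_R Hom_S(C, X) → Hom_S(Hom_{Rᵒᵖ}(P, C), X)`, `p ⊗ f ↦ (φ ↦ f (φ p))`. -/
def tensHom [SMulCommClass Rᵐᵒᵖ S C] (P X : Type u) [AddCommGroup P] [Module Rᵐᵒᵖ P]
    [AddCommGroup X] [Module S X] :
    Tens R P (HomMod S C X) →+ ((P →ₗ[Rᵐᵒᵖ] C) →ₗ[S] X) :=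
  Tens.lift R
    { toFun := fun p =>
        { toFun := fun f => LinearMap.comp (f : C →ₗ[S] X) (LinearMap.applyₗ' S p)
          map_zero' := rfl
          map_add' := fun _ _ => rfl }
      map_zero' := by
        ext f φ
        exact (congrArg f (map_zero φ)).trans (LinearMap.map_zero (f : C →ₗ[S] X))
      map_add' := fun p q => by
        ext f φ
        exact (congrArg f (map_add φ p q)).trans (LinearMap.map_add (f : C →ₗ[S] X) _ _) }
    (fun r p f => LinearMap.ext fun φ => congrArg f (map_smul φ (op r) p))

theorem tensHom_naturality [SMulCommClass Rᵐᵒᵖ S C] {P P' X : Type u} [AddCommGroup P]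
    [Module Rᵐᵒᵖ P] [AddCommGroup P'] [Module Rᵐᵒᵖ P'] [AddCommGroup X] [Module S X]
    (d : P →ₗ[Rᵐᵒᵖ] P') (t : Tens R P (HomMod S C X)) (φ : P' →ₗ[Rᵐᵒᵖ] C) :
    tensHom P' X (Tens.map R d LinearMap.id t) φ = tensHom P X t (φ ∘ₗ d) := by
  induction t using Tens.induction with
  | h0 => simp
  | ht p f => rfl
  | ha x y hx hy => rw [map_add, map_add, map_add, LinearMap.add_apply, LinearMap.add_apply, hx, hy]

/-- The inverse sends `h` to `∑ e i ⊗ (h ∘ σ i)` with `σ i c = φ i (-) • c`. -/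
theorem tensHom_bijective [SMulCommClass Rᵐᵒᵖ S C] (P X : Type u) [AddCommGroup P]
    [Module Rᵐᵒᵖ P] [AddCommGroup X] [Module S X] [Module.Projective Rᵐᵒᵖ P]
    [Module.Finite Rᵐᵒᵖ P] :
    Function.Bijective (tensHom (S := S) (R := R) (C := C) P X) := by
  obtain ⟨n, e, φ, hφ⟩ := exists_dualBasis Rᵐᵒᵖ P
  let σ : Fin n → C →ₗ[S] (P →ₗ[Rᵐᵒᵖ] C) := fun i =>
    { toFun := fun c => (φ i).smulRight c
      map_add' := fun c c' => by ext p; simp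
      map_smul' := fun s c => LinearMap.ext fun p => smul_comm (φ i p) s c }
  let τ : ((P →ₗ[Rᵐᵒᵖ] C) →ₗ[S] X) →+ Tens R P (HomMod S C X) := ∑ i, AddMonoidHom.comp
      ⟨⟨fun m => tmul R (e i) m, tmul_zero _⟩, fun m m' => tmul_add R _ m m'⟩
      (⟨⟨fun h => (h ∘ₗ σ i : C →ₗ[S] X), rfl⟩, fun _ _ => rfl⟩ :
        ((P →ₗ[Rᵐᵒᵖ] C) →ₗ[S] X) →+ HomMod S C X)
  have hτ : ∀ h, τ h = ∑ i, tmul R (e i) (show HomMod S C X from h ∘ₗ σ i) := fun h => by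
    rw [AddMonoidHom.finsetSum_apply]; rfl
  constructor
  · refine Function.LeftInverse.injective (g := τ) fun t => ?_
    refine DFunLike.congr_fun (f := τ.comp (tensHom P X)) (g := AddMonoidHom.id _)
      (Tens.hom_ext R fun p f => ?_) t
    rw [AddMonoidHom.comp_apply, hτ]
    have : ∀ i, (show HomMod S C X from tensHom P X (tmul R p f) ∘ₗ σ i) =
        (φ i p).unop • f := by
      intro i
      refine LinearMap.ext fun c => ?_
      rfl
    refine (Finset.sum_congr rfl fun i _ => ?_ : _ = ∑ i, tmul R (φ i p • e i) f).trans ?_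
    · exact (congrArg (tmul R (e i)) (this i)).trans (smul_tmul R _ _ _).symm
    · rw [← sum_tmul, hφ]; rfl
  · refine Function.RightInverse.surjective (g := τ) fun h => ?_
    refine LinearMap.ext fun ψ => ?_
    rw [hτ, map_sum, LinearMap.sum_apply]
    change ∑ i, h (σ i (ψ (e i))) = h ψ
    rw [← map_sum]
    congr 1
    ext p
    rw [LinearMap.sum_apply]
    change ∑ i, φ i p • ψ (e i) = ψ p
    conv_rhs => rw [← hφ p, map_sum]
    simp

/-- The map `Hom_S(P, C) ⊗_R Y → Hom_S(P, C ⊗_R Y)`, `φ ⊗ y ↦ (p ↦ φ p ⊗ y)`. -/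
def homTens (P Y : Type u) [AddCommGroup P] [Module S P] [AddCommGroup Y] [Module R Y] :
    Tens R (P →ₗ[S] C) Y →+ (P →ₗ[S] Tens R C Y) :=
  Tens.lift R
    { toFun := fun φ =>
        { toFun := fun y =>
            { toFun := fun p => tmul R (φ p) y
              map_add' := fun p q => by rw [map_add, add_tmul]
              map_smul' := fun s p => by rw [map_smul]; rfl }
          map_zero' := LinearMap.ext fun p => tmul_zero _
          map_add' := fun y y' => LinearMap.ext fun p => tmul_add R _ y y' }
      map_zero' := AddMonoidHom.ext fun y => LinearMap.ext fun p => zero_tmul y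
      map_add' := fun φ ψ => AddMonoidHom.ext fun y => LinearMap.ext fun p =>
        add_tmul R (φ p) (ψ p) y }
    (fun r φ y => LinearMap.ext fun p => smul_tmul R r (φ p) y)

theorem homTens_naturality {P P' Y : Type u} [AddCommGroup P] [Module S P] [AddCommGroup P']
    [Module S P'] [AddCommGroup Y] [Module R Y] (d : P →ₗ[S] P') (t : Tens R (P' →ₗ[S] C) Y) :
    homTens P Y (Tens.map R (LinearMap.lcomp Rᵐᵒᵖ C d) LinearMap.id t) =
      homTens P' Y t ∘ₗ d := by
  induction t using Tens.induction with
  | h0 => simp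
  | ht p f => rfl
  | ha x y hx hy => rw [map_add, map_add, map_add, hx, hy, LinearMap.add_comp]

/-- The inverse sends `h` to `∑ (σ i ⊗ 1) (h (e i))` with `σ i c = φ i (-) • c`. -/
theorem homTens_bijective (P Y : Type u) [AddCommGroup P] [Module S P] [AddCommGroup Y]
    [Module R Y] [Module.Projective S P] [Module.Finite S P] :
    Function.Bijective (homTens (R := R) (S := S) (C := C) P Y) := by
  obtain ⟨n, e, φ, hφ⟩ := exists_dualBasis S P
  let σ : Fin n → C →ₗ[Rᵐᵒᵖ] (P →ₗ[S] C) := fun i =>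
    { toFun := fun c => (φ i).smulRight c
      map_add' := fun c c' => by ext p; simp
      map_smul' := fun r c => LinearMap.ext fun p => smul_comm (φ i p) r c }
  let τ : (P →ₗ[S] Tens R C Y) →+ Tens R (P →ₗ[S] C) Y := ∑ i, AddMonoidHom.comp
    (Tens.map R (σ i) LinearMap.id)
    (⟨⟨fun h => h (e i), rfl⟩, fun _ _ => rfl⟩ : (P →ₗ[S] Tens R C Y) →+ Tens R C Y)
  have hτ : ∀ h, τ h = ∑ i, Tens.map R (σ i) LinearMap.id (h (e i)) := fun h => by
    rw [AddMonoidHom.finsetSum_apply]; rfl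
  have hσ : ∀ (i : Fin n) (t : Tens R C Y) (p : P),
      homTens P Y (Tens.map R (σ i) LinearMap.id t) p = φ i p • t := by
    intro i t p
    induction t using Tens.induction with
    | h0 => simp
    | ht c y => rfl
    | ha x y hx hy => rw [map_add, map_add, LinearMap.add_apply, hx, hy, smul_add]
  constructor
  · refine Function.LeftInverse.injective (g := τ) fun t => ?_
    refine DFunLike.congr_fun (f := τ.comp (homTens P Y)) (g := AddMonoidHom.id _)
      (Tens.hom_ext R fun ψ y => ?_) t
    rw [AddMonoidHom.comp_apply, hτ]
    change ∑ i, tmul R (σ i (ψ (e i))) y = tmul R ψ y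
    rw [← sum_tmul]
    congr 1
    ext p
    rw [LinearMap.sum_apply]
    change ∑ i, φ i p • ψ (e i) = ψ p
    conv_rhs => rw [← hφ p, map_sum]
    simp
  · refine Function.RightInverse.surjective (g := τ) fun h => ?_
    ext p
    rw [hτ, map_sum, LinearMap.sum_apply]
    simp_rw [hσ]
    conv_rhs => rw [← hφ p, map_sum]
    simp

end DualBasis

/-! ### Finitely `n`-presented modules -/

section FinitelyPresented

/-- Recursive form of being finitely `n`-presented. -/
def IsFP (R : Type u) [Ring R] : ℕ → (M : Type u) → [AddCommGroup M] → [Module R M] → Prop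
  | 0, M, _, _ => Module.Finite R M
  | n + 1, M, _, _ => ∃ F : ModuleCat.{u} R, Module.Free R F ∧ Module.Finite R F ∧
      ∃ f : F →ₗ[R] M, Function.Surjective f ∧ IsFP R n (LinearMap.ker f)

variable {R : Type u} [Ring R] {A B C : Type u} [AddCommGroup A] [Module R A] [AddCommGroup B]
  [Module R B] [AddCommGroup C] [Module R C]

theorem IsFP.finite {n : ℕ} (h : IsFP R n A) : Module.Finite R A := by
  cases n with
  | zero => exact h
  | succ n =>
    obtain ⟨F, -, hF, f, hf, -⟩ := h
    exact Module.Finite.of_surjective f hf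

theorem IsFP.of_succ {n : ℕ} (h : IsFP R (n + 1) A) : IsFP R n A := by
  induction n generalizing A with
  | zero => exact h.finite
  | succ n ih =>
    obtain ⟨F, h1, h2, f, hf, hk⟩ := h
    exact ⟨F, h1, h2, f, hf, ih hk⟩

theorem IsFP.of_equiv {n : ℕ} (h : IsFP R n A) (e : A ≃ₗ[R] B) : IsFP R n B := by
  induction n generalizing A B with
  | zero => exact Module.Finite.of_surjective (hM := h) e.toLinearMap e.surjective
  | succ n ih =>
    obtain ⟨F, h1, h2, f, hf, hk⟩ := h
    exact ⟨F, h1, h2, e.toLinearMap ∘ₗ f, e.surjective.comp hf,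
      ih hk (LinearEquiv.ofEq _ _ (LinearEquiv.ker_comp e f).symm)⟩

/-- Horseshoe argument: lifting the cover of `C` through `g` gives a cover `F × G → B` whose kernel
is an extension of `ker c` by `ker a`, to which induction applies. -/
theorem IsFP.of_exact {n : ℕ} {f : A →ₗ[R] B} {g : B →ₗ[R] C} (hf : Function.Injective f)
    (hfg : Function.Exact f g) (hg : Function.Surjective g) (hA : IsFP R n A) (hC : IsFP R n C) :
    IsFP R n B := by
  induction n generalizing A B C with
  | zero =>
    have := hA.finite
    have := hC.finite
    exact Module.Finite.of_exact hfg hg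
  | succ n ih =>
    obtain ⟨F, _, _, a, ha, hka⟩ := hA
    obtain ⟨G, _, _, c, hc, hkc⟩ := hC
    have : Module.Projective R G := Module.Projective.of_free
    obtain ⟨c', hc'⟩ := Module.projective_lifting_property g c hg
    have hc'' : ∀ y, g (c' y) = c y := fun y => LinearMap.congr_fun hc' y
    let h : F × G →ₗ[R] B := LinearMap.coprod (f ∘ₗ a) c'
    have hh : ∀ x y, h (x, y) = f (a x) + c' y := fun x y => rfl
    have hgf : ∀ x, g (f x) = 0 := hfg.apply_apply_eq_zero
    refine ⟨ModuleCat.of R (F × G), inferInstanceAs (Module.Free R (F × G)),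
      inferInstanceAs (Module.Finite R (F × G)), h, ?_, ?_⟩
    · intro b
      obtain ⟨y, hy⟩ := hc (g b)
      obtain ⟨x', hx'⟩ := (hfg (b - c' y)).1 (by rw [map_sub, hc'', hy, sub_self])
      obtain ⟨x, rfl⟩ := ha x'
      exact ⟨(x, y), by rw [hh, hx', sub_add_cancel]⟩
    · let i : LinearMap.ker a →ₗ[R] LinearMap.ker h :=
        ((LinearMap.inl R F G) ∘ₗ (LinearMap.ker a).subtype).codRestrict _ fun x => by
          change h (x.1, 0) = 0
          rw [hh, x.2, map_zero, map_zero, add_zero]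
      let p : LinearMap.ker h →ₗ[R] LinearMap.ker c :=
        ((LinearMap.snd R F G) ∘ₗ (LinearMap.ker h).subtype).codRestrict _ fun x => by
          have h1 : f (a x.1.1) + c' x.1.2 = 0 := x.2
          have h2 := congrArg g h1
          rw [map_add, hgf, zero_add, hc'', map_zero] at h2
          exact h2
      refine ih (f := i) (g := p) ?_ ?_ ?_ hka hkc
      · intro x y hxy
        exact Subtype.ext (congrArg (fun z => z.1.1) hxy)
      · intro z
        constructor
        · intro hz
          have h0 : z.1.2 = 0 := congrArg Subtype.val hz
          have h1 : f (a z.1.1) + c' z.1.2 = 0 := z.2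
          rw [h0, map_zero, add_zero] at h1
          exact ⟨⟨z.1.1, hf (h1.trans (map_zero f).symm)⟩, Subtype.ext (Prod.ext rfl h0.symm)⟩
        · rintro ⟨x, rfl⟩
          rfl
      · rintro ⟨y, hy⟩
        obtain ⟨x', hx'⟩ := (hfg (c' y)).1 (by rw [hc'']; exact hy)
        obtain ⟨x, rfl⟩ := ha x'
        refine ⟨⟨(-x, y), ?_⟩, rfl⟩
        change h (-x, y) = 0
        rw [hh, map_neg, map_neg, hx', neg_add_cancel]

/-- Cover `C` by the cover `p` of `B`. The kernel of `g ∘ p` is an extension of `range f ≅ A` by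
`ker p`, hence finitely `n`-presented. -/
theorem IsFP.quotient {n : ℕ} {f : A →ₗ[R] B} {g : B →ₗ[R] C} (hf : Function.Injective f)
    (hfg : Function.Exact f g) (hg : Function.Surjective g) (hA : IsFP R n A)
    (hB : IsFP R (n + 1) B) : IsFP R (n + 1) C := by
  obtain ⟨F, h1, h2, p, hp, hk⟩ := hB
  refine ⟨F, h1, h2, g ∘ₗ p, hg.comp hp, ?_⟩
  let i : LinearMap.ker p →ₗ[R] LinearMap.ker (g ∘ₗ p) :=
    (LinearMap.ker p).subtype.codRestrict _ fun x => by
      change g (p x) = 0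
      rw [x.2, map_zero]
  let q : LinearMap.ker (g ∘ₗ p) →ₗ[R] LinearMap.range f :=
    (p ∘ₗ (LinearMap.ker (g ∘ₗ p)).subtype).codRestrict _ fun x => (hfg _).1 x.2
  refine IsFP.of_exact (f := i) (g := q) ?_ ?_ ?_ hk
    (hA.of_equiv (LinearEquiv.ofInjective f hf))
  · intro x y hxy
    exact Subtype.ext (congrArg (fun z => z.1) hxy)
  · intro z
    constructor
    · intro hz
      exact ⟨⟨z.1, congrArg Subtype.val hz⟩, rfl⟩
    · rintro ⟨x, rfl⟩
      exact Subtype.ext x.2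
  · rintro ⟨y, x, rfl⟩
    obtain ⟨z, hz⟩ := hp (f x)
    exact ⟨⟨z, by change g (p z) = 0; rw [hz]; exact hfg.apply_apply_eq_zero x⟩, Subtype.ext hz⟩

theorem IsFP.of_subsingleton (n : ℕ) [Subsingleton A] : IsFP R n A := by
  induction n generalizing A with
  | zero => exact (inferInstance : Module.Finite R A)
  | succ n ih =>
    exact ⟨ModuleCat.of R PUnit.{u + 1}, inferInstanceAs (Module.Free R PUnit.{u + 1}),
      inferInstanceAs (Module.Finite R PUnit.{u + 1}), 0, fun _ => ⟨0, Subsingleton.elim _ _⟩, ih⟩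

theorem IsFP.of_free (n : ℕ) [h1 : Module.Free R A] [h2 : Module.Finite R A] : IsFP R n A := by
  cases n with
  | zero => exact h2
  | succ n =>
    refine ⟨ModuleCat.of R A, h1, h2, LinearMap.id, Function.surjective_id, ?_⟩
    have : Subsingleton (LinearMap.ker (LinearMap.id : A →ₗ[R] A)) :=
      ⟨fun x y => Subtype.ext (Eq.trans x.2 (Eq.symm y.2))⟩
    exact IsFP.of_subsingleton n

/-- The kernel of `r` is itself a retract of `B`, through `1 - i r`. By induction it is finitely
presented one level lower, and `A` is the quotient of `B` by it. -/
theorem IsFP.of_retract {n : ℕ} {i : A →ₗ[R] B} {r : B →ₗ[R] A} (h : r ∘ₗ i = LinearMap.id)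
    (hB : IsFP R n B) : IsFP R n A := by
  have hri : ∀ x, r (i x) = x := LinearMap.congr_fun h
  have hr : Function.Surjective r := fun x => ⟨i x, hri x⟩
  induction n generalizing A B with
  | zero =>
    have := hB.finite
    exact Module.Finite.of_surjective r hr
  | succ n ih =>
    refine IsFP.quotient (f := (LinearMap.ker r).subtype) (g := r) Subtype.val_injective
      (LinearMap.exact_subtype_ker_map r) hr ?_ hB
    let ρ : B →ₗ[R] LinearMap.ker r := (LinearMap.id - i ∘ₗ r).codRestrict _ fun x => by
      change r (x - i (r x)) = 0
      rw [map_sub, hri, sub_self]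
    have hρ : ∀ x, ρ ((LinearMap.ker r).subtype x) = x := fun x => Subtype.ext <| by
      change x.1 - i (r x.1) = x.1
      rw [x.2, map_zero, sub_zero]
    exact ih (LinearMap.ext hρ) hB.of_succ hρ fun x => ⟨_, hρ x⟩

theorem IsFP.pi {n : ℕ} (hA : IsFP R n A) (m : ℕ) : IsFP R n (Fin m → A) := by
  induction m with
  | zero => exact IsFP.of_subsingleton n
  | succ m ih =>
    refine IsFP.of_exact (f := LinearMap.single R (fun _ : Fin (m + 1) => A) 0)
      (g := LinearMap.funLeft R A Fin.succ)
      (fun x y h => by simpa using congrFun h 0) ?_ ?_ hA ih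
    · intro v
      constructor
      · intro hv
        refine ⟨v 0, funext fun j => ?_⟩
        refine Fin.cases ?_ (fun j => ?_) j
        · simp
        · have := congrFun hv j
          simp only [LinearMap.funLeft_apply] at this
          rw [this]; simp
      · rintro ⟨x, rfl⟩
        ext j
        simp [LinearMap.funLeft_apply]
    · exact fun v => ⟨Fin.cons 0 v, funext fun j => by simp [LinearMap.funLeft_apply]⟩

theorem IsFP.of_projective (n : ℕ) [Module.Projective R A] [Module.Finite R A] : IsFP R n A := by
  obtain ⟨m, f, g, -, -, hfg⟩ := Module.Finite.exists_comp_eq_id_of_projective R A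
  exact IsFP.of_retract hfg (IsFP.pi (IsFP.of_free n) m)

/-- The sequence of modules `G, F 0, F 1, …`. -/
def consObj (G : ModuleCat.{u} R) (F : ℕ → ModuleCat.{u} R) : ℕ → ModuleCat.{u} R
  | 0 => G
  | i + 1 => F i

/-- The sequence of maps `e, d 0, d 1, …`. -/
def consMap {G : ModuleCat.{u} R} {F : ℕ → ModuleCat.{u} R} (d : ∀ i, F (i + 1) →ₗ[R] F i)
    (e : F 0 →ₗ[R] G) : ∀ i, consObj G F (i + 1) →ₗ[R] consObj G F i
  | 0 => e
  | i + 1 => d i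

/-- This direction suffices: test modules are constructed with `IsFP`, while `fpInj` and `fpFlat`
consume `IsFinitelyNPresented`. -/
theorem IsFP.isFinitelyNPresented {n : ℕ} (h : IsFP R n A) :
    IsFinitelyNPresented n (ModuleCat.of R A) := by
  induction n generalizing A with
  | zero =>
    have := h.finite
    obtain ⟨m, f, hf⟩ := Module.Finite.exists_fin' R A
    refine ⟨fun _ => ModuleCat.of R (Fin m → R), fun _ => 0, f, fun i _ =>
      ⟨inferInstanceAs (Module.Free R (Fin m → R)),
        inferInstanceAs (Module.Finite R (Fin m → R))⟩, hf, fun h => ?_, fun i h => ?_⟩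
    · omega
    · omega
  | succ n ih =>
    obtain ⟨G, h1, h2, f, hf, hk⟩ := h
    obtain ⟨F, d, ε, hF, hε, h0, hs⟩ := ih hk
    refine ⟨consObj G F, consMap d ((LinearMap.ker f).subtype ∘ₗ ε), f, ?_, hf, fun _ => ?_, ?_⟩
    · rintro (_ | i) hi
      · exact ⟨h1, h2⟩
      · exact hF i (by omega)
    · intro x
      constructor
      · intro hx
        obtain ⟨y, hy⟩ := hε ⟨x, hx⟩
        exact ⟨y, congrArg Subtype.val hy⟩
      · rintro ⟨y, rfl⟩
        exact (ε y).2
    · rintro (_ | i) hi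
      · intro x
        refine Iff.trans ?_ (h0 (by omega) x)
        exact (Subtype.ext_iff (a1 := ε x) (a2 := 0)).symm
      · exact hs i (by omega)

end FinitelyPresented

/-! ### Syzygies, cosyzygies and the use of test injections -/

section Extension

variable {R : Type u} [Ring R]

/-- The range of `g` is `B` modulo the range of `f`. The gain of one level drives the inductions on
syzygies and on cosyzygies. -/
theorem range_exact_quotient {A B C : Type u} [AddCommGroup A] [Module R A] [AddCommGroup B]
    [Module R B] [AddCommGroup C] [Module R C] {f : A →ₗ[R] B} {g : B →ₗ[R] C} {n : ℕ}
    (hfg : Function.Exact f g) (hA : IsFP R n (LinearMap.range f)) (hB : IsFP R (n + 1) B) :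
    IsFP R (n + 1) (LinearMap.range g) := by
  refine IsFP.quotient (f := (LinearMap.range f).subtype) (g := g.rangeRestrict)
    Subtype.val_injective ?_ g.surjective_rangeRestrict hA hB
  intro x
  refine Iff.trans (Subtype.ext_iff (a1 := g.rangeRestrict x) (a2 := 0)) ?_
  refine Iff.trans (hfg x) ?_
  exact ⟨fun h => ⟨⟨x, h⟩, rfl⟩, by rintro ⟨y, rfl⟩; exact y.2⟩

/-- The syzygies in a resolution by finitely generated projectives are finitely `n`-presented. -/
theorem IsLeftResolution.isFP_range {M : ModuleCat.{u} R} {P : ℕ → ModuleCat.{u} R}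
    {d : ∀ i, P (i + 1) →ₗ[R] P i} {ε : P 0 →ₗ[R] M} (h : IsLeftResolution P d ε)
    (hP : ∀ i, Module.Projective R (P i) ∧ Module.Finite R (P i)) (n i : ℕ) :
    IsFP R n (LinearMap.range (d i)) := by
  induction n generalizing i with
  | zero =>
    have := (hP (i + 1)).2
    exact Module.Finite.range (d i)
  | succ n ih =>
    have := (hP (i + 1)).1
    have := (hP (i + 1)).2
    -- Level `n` for the next syzygy gives level `n + 1` for this one, so the induction on `n` keeps
    -- `i` general.
    exact range_exact_quotient (h.exact_succ i) (ih (i + 1)) (IsFP.of_projective _)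

theorem HasDegreewiseFiniteResolution.isFP {M : ModuleCat.{u} R}
    (h : HasDegreewiseFiniteResolution M) (n : ℕ) : IsFP R n M := by
  obtain ⟨P, d, ε, h, hP⟩ := h
  have := (hP 0).1
  have := (hP 0).2
  have := range_exact_quotient h.exact_zero (h.isFP_range hP n 0) (IsFP.of_projective _)
  exact (this.of_equiv (LinearEquiv.ofTop _ (LinearMap.range_eq_top.2 h.surjective))).of_succ

/-- The cosyzygies in a coresolution of a finitely `n`-presented module by finitely `n`-presented
modules are finitely `n`-presented. -/
theorem isFP_range_of_coresolution {A : Type u} [AddCommGroup A] [Module R A] {D : ℕ → Type u}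
    [∀ i, AddCommGroup (D i)] [∀ i, Module R (D i)] {δ : ∀ i, D i →ₗ[R] D (i + 1)}
    {η : A →ₗ[R] D 0} (hη : Function.Injective η) (h0 : Function.Exact η (δ 0))
    (hs : ∀ i, Function.Exact (δ i) (δ (i + 1))) (n : ℕ) (hA : IsFP R n A)
    (hD : ∀ i, IsFP R (n + 1) (D i)) (i : ℕ) : IsFP R n (LinearMap.range (δ i)) := by
  induction i with
  | zero =>
    exact (range_exact_quotient h0 (hA.of_equiv (LinearEquiv.ofInjective η hη)) (hD 0)).of_succ
  | succ i ih => exact (range_exact_quotient (hs i) ih (hD _)).of_succ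

variable {A B : Type u} [AddCommGroup A] [Module R A] [AddCommGroup B] [Module R B]

/-- Since `f` vanishes on `ker d`, it descends to `range d`; the inclusion of `range d` in `B` is
then a legitimate test injection. -/
theorem fpInj.exists_extend {n : ℕ} {X : ModuleCat.{u} R} (hX : fpInj n X) {d : A →ₗ[R] B}
    (hd : IsFP R n (LinearMap.range d)) (hB : IsFP R n B) (f : A →ₗ[R] X)
    (hf : ∀ x, d x = 0 → f x = 0) : ∃ g : B →ₗ[R] X, g ∘ₗ d = f := by
  have hk : LinearMap.ker d ≤ LinearMap.ker f := hf
  let f' : LinearMap.range d →ₗ[R] X :=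
    (LinearMap.ker d).liftQ f hk ∘ₗ d.quotKerEquivRange.symm.toLinearMap
  obtain ⟨g, hg⟩ := hX (ModuleCat.of R (LinearMap.range d)) (ModuleCat.of R B)
    hd.isFinitelyNPresented hB.isFinitelyNPresented (LinearMap.range d).subtype
    Subtype.val_injective f'
  refine ⟨g, LinearMap.ext fun x => ?_⟩
  have h1 : g (d x) = f' ⟨d x, x, rfl⟩ := LinearMap.congr_fun hg ⟨d x, x, rfl⟩
  have h2 : d.quotKerEquivRange.symm ⟨d x, x, rfl⟩ = Submodule.Quotient.mk x := by
    rw [LinearEquiv.symm_apply_eq]; rfl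
  rw [LinearMap.comp_apply, h1]
  change (LinearMap.ker d).liftQ f hk (d.quotKerEquivRange.symm ⟨d x, x, rfl⟩) = f x
  rw [h2]; rfl

theorem fpFlat.map_injective {n : ℕ} {Y : ModuleCat.{u} R} (hY : fpFlat n Y) {A B : Type u}
    [AddCommGroup A] [Module Rᵐᵒᵖ A] [AddCommGroup B] [Module Rᵐᵒᵖ B] (hA : IsFP Rᵐᵒᵖ n A)
    (hB : IsFP Rᵐᵒᵖ n B) {f : A →ₗ[Rᵐᵒᵖ] B} (hf : Function.Injective f) :
    Function.Injective (Tens.map R f (LinearMap.id : Y →ₗ[R] Y)) :=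
  hY (ModuleCat.of _ A) (ModuleCat.of _ B) hA.isFinitelyNPresented hB.isFinitelyNPresented f hf

/-- Factor `g` through its range: the first factor is handled by right exactness, and the inclusion
of the range stays injective after tensoring with `Y`. -/
theorem fpFlat.exact {n : ℕ} {Y : ModuleCat.{u} R} (hY : fpFlat n Y) {A B D : Type u}
    [AddCommGroup A] [Module Rᵐᵒᵖ A] [AddCommGroup B] [Module Rᵐᵒᵖ B] [AddCommGroup D]
    [Module Rᵐᵒᵖ D] {f : A →ₗ[Rᵐᵒᵖ] B} {g : B →ₗ[Rᵐᵒᵖ] D} (hfg : Function.Exact f g)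
    (hg : IsFP Rᵐᵒᵖ n (LinearMap.range g)) (hD : IsFP Rᵐᵒᵖ n D) :
    Function.Exact (Tens.map R f (LinearMap.id : Y →ₗ[R] Y)) (Tens.map R g LinearMap.id) := by
  have h1 : Function.Exact f g.rangeRestrict := fun x =>
    Iff.trans (Subtype.ext_iff (a1 := g.rangeRestrict x) (a2 := 0)) (hfg x)
  have h2 := Tens.exact_left (M := Y) h1 g.surjective_rangeRestrict
  have h3 := hY.map_injective hg hD (f := (LinearMap.range g).subtype) Subtype.val_injective
  have h4 : Tens.map R g (LinearMap.id : Y →ₗ[R] Y) =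
      (Tens.map R (LinearMap.range g).subtype LinearMap.id).comp
        (Tens.map R g.rangeRestrict LinearMap.id) := by
    rw [← Tens.map_comp]; rfl
  intro x
  rw [h4, AddMonoidHom.comp_apply]
  exact Iff.trans ⟨fun h => h3 (h.trans (map_zero _).symm), fun h => by rw [h, map_zero]⟩ (h2 x)

end Extension

/-! ### The dual coresolution `0 → B → Hom(P₀, C) → Hom(P₁, C) → ⋯` -/

section DualCoresolution

theorem exists_factor {A : Type u} [Ring A] {K P C X : Type u} [AddCommGroup K] [Module A K]
    [AddCommGroup P] [Module A P] [AddCommGroup C] [Module A C] [AddCommGroup X] [Module A X]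
    {d : K →ₗ[A] P} {ε : P →ₗ[A] C} (h : Function.Exact d ε) (hε : Function.Surjective ε)
    (f : P →ₗ[A] X) (hf : ∀ x, f (d x) = 0) : ∃ g : C →ₗ[A] X, ∀ x, g (ε x) = f x := by
  have hk : LinearMap.ker ε ≤ LinearMap.ker f := by
    intro x hx
    obtain ⟨y, rfl⟩ := (h x).1 hx
    exact hf y
  refine ⟨(LinearMap.ker ε).liftQ f hk ∘ₗ (ε.quotKerEquivOfSurjective hε).symm.toLinearMap,
    fun x => ?_⟩
  have : (ε.quotKerEquivOfSurjective hε).symm (ε x) = Submodule.Quotient.mk x := by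
    rw [LinearEquiv.symm_apply_eq]; rfl
  change (LinearMap.ker ε).liftQ f hk ((ε.quotKerEquivOfSurjective hε).symm (ε x)) = f x
  rw [this]; rfl

variable {A B : Type u} [Ring A] [Ring B] {C : Type u} [AddCommGroup C] [Module A C] [Module B C]
  [SMulCommClass A B C]

/-- A dual basis of `P` makes `Hom_A(P, C)` a `B`-linear retract of a finite power of `C`. -/
theorem IsFP.hom {n : ℕ} (hC : IsFP B n C) (P : Type u) [AddCommGroup P] [Module A P]
    [Module.Projective A P] [Module.Finite A P] : IsFP B n (P →ₗ[A] C) := by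
  obtain ⟨m, e, φ, hφ⟩ := exists_dualBasis A P
  let i : (P →ₗ[A] C) →ₗ[B] (Fin m → C) :=
    { toFun := fun ψ j => ψ (e j)
      map_add' := fun _ _ => rfl
      map_smul' := fun _ _ => rfl }
  let r : (Fin m → C) →ₗ[B] (P →ₗ[A] C) :=
    { toFun := fun v => ∑ j, (φ j).smulRight (v j)
      map_add' := fun v w => by
        rw [← Finset.sum_add_distrib]
        exact Finset.sum_congr rfl fun j _ => LinearMap.ext fun p => smul_add _ _ _
      map_smul' := fun b v => by
        rw [Finset.smul_sum]
        exact Finset.sum_congr rfl fun j _ => LinearMap.ext fun p => smul_comm (φ j p) b (v j) }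
  refine IsFP.of_retract (i := i) (r := r) ?_ (hC.pi m)
  ext ψ p
  change (∑ j, (φ j).smulRight (ψ (e j))) p = ψ p
  rw [LinearMap.sum_apply]
  conv_rhs => rw [← hφ p, map_sum]
  simp

variable {P : ℕ → ModuleCat.{u} A} {d : ∀ i, P (i + 1) →ₗ[A] P i}
  {ε : P 0 →ₗ[A] ModuleCat.of A C}

/-- The coaugmentation `B → Hom_A(P₀, C)`, `b ↦ b ε`. -/
def coaug (B : Type u) [Ring B] [Module B C] [SMulCommClass A B C] (ε : P 0 →ₗ[A] ModuleCat.of A C) :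
    B →ₗ[B] (P 0 →ₗ[A] C) :=
  LinearMap.toSpanSingleton B (P 0 →ₗ[A] C) ε

theorem coaug_injective (hε : Function.Surjective ε)
    (hi : ∀ b b' : B, (∀ c : C, b • c = b' • c) → b = b') :
    Function.Injective (coaug B ε) := by
  intro b b' h
  refine hi b b' fun c => ?_
  obtain ⟨x, rfl⟩ := hε c
  exact LinearMap.congr_fun h x

/-- A map `P 0 → C` killing the image of `d 0` factors through `ε` as an endomorphism of `C`, which
is a homothety. -/
theorem coaug_exact (h : IsLeftResolution P d ε)
    (hs : ∀ φ : C →ₗ[A] C, ∃ b : B, ∀ c, b • c = φ c) :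
    Function.Exact (coaug B ε) (LinearMap.lcomp B C (d 0)) := by
  intro φ
  constructor
  · intro hφ
    obtain ⟨ψ, hψ⟩ := exists_factor (X := C) h.exact_zero h.surjective φ (LinearMap.congr_fun hφ)
    obtain ⟨b, hb⟩ := hs ψ
    exact ⟨b, LinearMap.ext fun x => (hb _).trans (hψ x)⟩
  · rintro ⟨b, rfl⟩
    refine LinearMap.ext fun x => ?_
    have h0 : (ε (d 0 x) : C) = 0 := h.exact_zero.apply_apply_eq_zero x
    change b • (ε (d 0 x) : C) = 0
    rw [h0, smul_zero]

/-- In higher degrees exactness is the vanishing of `Ext(C, C)`. -/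
theorem lcomp_exact (h : IsLeftResolution P d ε) (hP : ∀ i, Module.Projective A (P i))
    (he : ∀ i : ℕ, 1 ≤ i →
      Subsingleton (Abelian.Ext.{u} (ModuleCat.of A C) (ModuleCat.of A C) i)) (i : ℕ) :
    Function.Exact (LinearMap.lcomp B C (d i)) (LinearMap.lcomp B C (d (i + 1))) := by
  intro φ
  constructor
  · exact fun hφ => (h.ext_iff hP _).1 he i φ hφ
  · rintro ⟨ψ, rfl⟩
    refine LinearMap.ext fun x => ?_
    exact (congrArg ψ ((h.exact_succ i).apply_apply_eq_zero x)).trans (map_zero ψ)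

/-- The pair `(A, B)` is kept abstract because this is applied both with `(Rᵐᵒᵖ, S)` and with `(S,
Rᵐᵒᵖ)`. -/
theorem isFP_range_lcomp (h : IsLeftResolution P d ε)
    (hP : ∀ i, Module.Projective A (P i) ∧ Module.Finite A (P i))
    (he : ∀ i : ℕ, 1 ≤ i →
      Subsingleton (Abelian.Ext.{u} (ModuleCat.of A C) (ModuleCat.of A C) i))
    (hi : ∀ b b' : B, (∀ c : C, b • c = b' • c) → b = b')
    (hs : ∀ φ : C →ₗ[A] C, ∃ b : B, ∀ c, b • c = φ c) (hC : ∀ n, IsFP B n C) (n i : ℕ) :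
    IsFP B n (LinearMap.range (LinearMap.lcomp B C (d i))) := by
  refine isFP_range_of_coresolution (D := fun i => P i →ₗ[A] C)
    (δ := fun i => LinearMap.lcomp B C (d i)) (η := coaug B ε) (coaug_injective h.surjective hi)
    (coaug_exact h hs) (lcomp_exact h (fun i => (hP i).1) he) n (IsFP.of_free n) (fun i => ?_) i
  have := (hP i).1
  have := (hP i).2
  exact (hC (n + 1)).hom (P i)

end DualCoresolution

/-! ### `fp_n`-injectives in the Bass class, `fp_n`-flats in the Auslander class -/

section Membership

variable {R S : Type u} [Ring R] [Ring S] {C : Type u}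
  [AddCommGroup C] [Module S C] [Module Rᵐᵒᵖ C] [SMulCommClass S Rᵐᵒᵖ C]

theorem Tens.map_map_eq_zero {K K' K'' M : Type u} [AddCommGroup K] [Module Rᵐᵒᵖ K]
    [AddCommGroup M] [Module R M] [AddCommGroup K'] [Module Rᵐᵒᵖ K'] [AddCommGroup K'']
    [Module Rᵐᵒᵖ K''] {f : K →ₗ[Rᵐᵒᵖ] K'} {g : K' →ₗ[Rᵐᵒᵖ] K''} (h : Function.Exact f g)
    (x : Tens R K M) : Tens.map R g LinearMap.id (Tens.map R f LinearMap.id x) = 0 := by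
  induction x using Tens.induction with
  | h0 => simp
  | ht k m => rw [Tens.map_tmul, Tens.map_tmul, h.apply_apply_eq_zero, zero_tmul]
  | ha x y hx hy => rw [map_add, map_add, hx, hy, add_zero]

theorem homExact_of_fpInj {A : Type u} [Ring A] {M : ModuleCat.{u} A} {P : ℕ → ModuleCat.{u} A}
    {d : ∀ i, P (i + 1) →ₗ[A] P i} {ε : P 0 →ₗ[A] M} (h : IsLeftResolution P d ε)
    (hP : ∀ i, Module.Projective A (P i) ∧ Module.Finite A (P i)) {n : ℕ} {X : ModuleCat.{u} A}
    (hX : fpInj n X) : HomExact P d X := by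
  intro i f hf
  have := (hP i).1
  have := (hP i).2
  refine hX.exists_extend (h.isFP_range hP n i) (IsFP.of_projective n) f fun x hx => ?_
  obtain ⟨y, rfl⟩ := (h.exact_succ i x).1 hx
  exact LinearMap.congr_fun hf y

theorem tensExact_of_fpFlat {M : ModuleCat.{u} Rᵐᵒᵖ} {P : ℕ → ModuleCat.{u} Rᵐᵒᵖ}
    {d : ∀ i, P (i + 1) →ₗ[Rᵐᵒᵖ] P i} {ε : P 0 →ₗ[Rᵐᵒᵖ] M} (h : IsLeftResolution P d ε)
    (hP : ∀ i, Module.Projective Rᵐᵒᵖ (P i) ∧ Module.Finite Rᵐᵒᵖ (P i)) {n : ℕ}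
    {Y : ModuleCat.{u} R} (hY : fpFlat n Y) : TensExact P d Y := by
  intro i
  have := (hP i).1
  have := (hP i).2
  exact hY.exact (h.exact_succ i) (h.isFP_range hP n i) (IsFP.of_projective n)

/-- Every `fp_n`-injective module lies in the Bass class. -/
theorem IsSemidualizing.bassClass_of_fpInj (hC : IsSemidualizing R S C) {n : ℕ}
    {X : ModuleCat.{u} S} (hX : fpInj n X) : bassClass R S C X := by
  have : SMulCommClass Rᵐᵒᵖ S C := SMulCommClass.symm S Rᵐᵒᵖ C
  have hCfp := hC.resolution_left.isFP
  obtain ⟨L, dL, εL, hL, hLp⟩ := hC.resolution_left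
  obtain ⟨P, d, ε, hP, hPp⟩ := hC.resolution_right
  have hi : ∀ b b' : S, (∀ c : C, b • c = b' • c) → b = b' := fun b b' h =>
    hC.homothety_left.1 (LinearMap.ext h)
  have hs : ∀ φ : C →ₗ[Rᵐᵒᵖ] C, ∃ b : S, ∀ c, b • c = φ c := fun φ => by
    obtain ⟨b, hb⟩ := hC.homothety_left.2 φ
    exact ⟨b, LinearMap.congr_fun hb⟩
  have hD : ∀ i, IsFP S n (P i →ₗ[Rᵐᵒᵖ] C) := fun i => by
    have := (hPp i).1
    have := (hPp i).2
    exact (hCfp n).hom (P i)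
  have hr := isFP_range_lcomp hP hPp hC.ext_right hi hs hCfp n
  have hθ : ∀ i, Function.Bijective (tensHom (R := R) (S := S) (C := C) (P i) X) := fun i => by
    have := (hPp i).1
    have := (hPp i).2
    exact tensHom_bijective (P i) X
  refine ⟨(hL.ext_iff (fun i => (hLp i).1) X).2 (homExact_of_fpInj hL hLp hX),
    (hP.tor_iff (fun i => (hPp i).1) _).2 fun i x => ⟨fun hx => ?_, ?_⟩, ?_, ?_⟩
  -- A cycle `x` is a map on `Hom(P (i+1), C)` vanishing on the image of `Hom(P i, C)`, which is the
  -- kernel of the next map. Extending it to `Hom(P (i+2), C)` exhibits `x` as a boundary.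
  · obtain ⟨g, hg⟩ := hX.exists_extend (hr (i + 1)) (hD _) (tensHom (P (i + 1)) X x) fun φ hφ => by
      obtain ⟨ψ, rfl⟩ := (lcomp_exact hP (fun i => (hPp i).1) hC.ext_right i φ).1 hφ
      refine (tensHom_naturality (d i) x ψ).symm.trans ?_
      erw [hx]
      rw [map_zero]; rfl
    obtain ⟨y, rfl⟩ := (hθ _).2 g
    exact ⟨y, (hθ _).1 (LinearMap.ext fun φ =>
      (tensHom_naturality (d (i + 1)) y φ).trans (LinearMap.congr_fun hg φ))⟩
  · rintro ⟨y, rfl⟩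
    exact Tens.map_map_eq_zero (hP.exact_succ i) y
  -- Lift `t` to `u` over `P 0`. Then `ν t` is the value of `tensHom u` at `ε`, so `ν t = 0` means
  -- that `tensHom u` kills `S ε`, the kernel of the next map; extending makes `u` a boundary.
  · rw [injective_iff_map_eq_zero]
    intro t ht
    obtain ⟨u, rfl⟩ := Tens.map_surjective (R := R) (M := HomMod S C X) (g := LinearMap.id)
      hP.surjective Function.surjective_id t
    have hu : ∀ u : Tens R (P 0) (HomMod S C X), evalNu R S C X (Tens.map R ε LinearMap.id u) =
        tensHom (P 0) X u ε := fun u => by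
      induction u using Tens.induction with
      | h0 => simp
      | ht k m => rfl
      | ha x y hx hy => rw [map_add, map_add, map_add, hx, hy]; rfl
    obtain ⟨g, hg⟩ := hX.exists_extend (hr 0) (hD _) (tensHom (P 0) X u) fun φ hφ => by
      obtain ⟨s, rfl⟩ := (coaug_exact hP hs φ).1 hφ
      change tensHom (P 0) X u (s • (ε : P 0 →ₗ[Rᵐᵒᵖ] C)) = 0
      rw [map_smul, ← hu]
      erw [ht]
      rw [smul_zero]
    obtain ⟨y, rfl⟩ := (hθ _).2 g
    have : u = Tens.map R (d 0) LinearMap.id y := (hθ _).1 (LinearMap.ext fun φ =>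
      (LinearMap.congr_fun hg φ).symm.trans (tensHom_naturality (d 0) y φ).symm)
    rw [this]
    exact Tens.map_map_eq_zero hP.exact_zero y
  · intro x
    -- Extend `s ↦ s x` along the injection `S → Hom(P 0, C)`; the extension takes `ε` to `x`.
    obtain ⟨g, hg⟩ := hX.exists_extend (d := coaug S ε) (n := n)
      ((IsFP.of_free n).of_equiv (LinearEquiv.ofInjective _ (coaug_injective hP.surjective hi)))
      (hD 0) (LinearMap.toSpanSingleton S X x) fun s hs => by
        have : s = 0 := coaug_injective hP.surjective hi (hs.trans (map_zero _).symm)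
        rw [this, map_zero]
    obtain ⟨u, rfl⟩ := (hθ _).2 g
    refine ⟨Tens.map R ε LinearMap.id u, ?_⟩
    have hu : ∀ u : Tens R (P 0) (HomMod S C X), evalNu R S C X (Tens.map R ε LinearMap.id u) =
        tensHom (P 0) X u (coaug S ε 1) := fun u => by
      induction u using Tens.induction with
      | h0 => simp
      | ht k m => exact congrArg m (one_smul S (ε k : C)).symm
      | ha x y hx hy => rw [map_add, map_add, map_add, hx, hy]; rfl
    exact ((hu u).trans (LinearMap.congr_fun hg 1)).trans (one_smul S x)

/-- Every `fp_n`-flat module lies in the Auslander class. -/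
theorem IsSemidualizing.auslanderClass_of_fpFlat (hC : IsSemidualizing R S C) {n : ℕ}
    {Y : ModuleCat.{u} R} (hY : fpFlat n Y) : auslanderClass R S C Y := by
  have hCfp := hC.resolution_right.isFP
  obtain ⟨P, d, ε, hP, hPp⟩ := hC.resolution_left
  obtain ⟨Q, dQ, εQ, hQ, hQp⟩ := hC.resolution_right
  have hi : ∀ b b' : Rᵐᵒᵖ, (∀ c : C, b • c = b' • c) → b = b' := fun b b' h =>
    unop_injective (hC.homothety_right.1 (LinearMap.ext h))
  have hs : ∀ φ : C →ₗ[S] C, ∃ b : Rᵐᵒᵖ, ∀ c, b • c = φ c := fun φ => by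
    obtain ⟨b, hb⟩ := hC.homothety_right.2 φ
    exact ⟨op b, LinearMap.congr_fun hb⟩
  have hD : ∀ i, IsFP Rᵐᵒᵖ n (P i →ₗ[S] C) := fun i => by
    have := (hPp i).1
    have := (hPp i).2
    exact (hCfp n).hom (P i)
  have hr := isFP_range_lcomp hP hPp hC.ext_left hi hs hCfp n
  have hθ : ∀ i, Function.Bijective (homTens (R := R) (S := S) (C := C) (P i) Y) := fun i => by
    have := (hPp i).1
    have := (hPp i).2
    exact homTens_bijective (P i) Y
  -- This is the surjective half of `Y ≅ Rᵐᵒᵖ ⊗ Y`, the degree where the tensored dual coresolution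
  -- begins.
  have hone : ∀ t : Tens R Rᵐᵒᵖ Y, ∃ y : Y, t = tmul R 1 y := fun t => by
    induction t using Tens.induction with
    | h0 => exact ⟨0, (tmul_zero _).symm⟩
    | ht r y =>
      refine ⟨r.unop • y, ?_⟩
      rw [← smul_tmul, op_unop, smul_eq_mul, mul_one]
    | ha x y hx hy =>
      obtain ⟨x, rfl⟩ := hx
      obtain ⟨y, rfl⟩ := hy
      exact ⟨x + y, (tmul_add R _ _ _).symm⟩
  have hμ : ∀ (y : Y) (x : P 0), homTens (P 0) Y
      (Tens.map R (coaug Rᵐᵒᵖ ε) LinearMap.id (tmul R 1 y)) x = tmul R (ε x : C) y := by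
    intro y x
    exact congrArg (fun c : C => tmul R c y) (one_smul Rᵐᵒᵖ (ε x : C))
  refine ⟨(hQ.tor_iff (fun i => (hQp i).1) _).2 (tensExact_of_fpFlat hQ hQp hY),
    (hP.ext_iff (fun i => (hPp i).1) _).2 fun i f hf => ?_, ?_, ?_⟩
  -- Cocycles with values in `C ⊗ Y` become cycles in `Hom(P, C) ⊗ Y`, which is exact because `Y` is
  -- `fp_n`-flat.
  · obtain ⟨t, rfl⟩ := (hθ (i + 1)).2 f
    have h1 := homTens_naturality (d (i + 1)) t
    have h2 : Tens.map R (LinearMap.lcomp Rᵐᵒᵖ C (d (i + 1))) LinearMap.id t = 0 :=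
      (hθ _).1 (h1.trans (Eq.trans hf (map_zero _).symm))
    obtain ⟨s, rfl⟩ := (hY.exact (lcomp_exact hP (fun i => (hPp i).1) hC.ext_left i)
      (hr _) (hD _) t).1 h2
    exact ⟨homTens (P i) Y s, (homTens_naturality (d i) s).symm⟩
  · rw [injective_iff_map_eq_zero]
    intro y hy
    have h1 : Tens.map R (coaug Rᵐᵒᵖ ε) (LinearMap.id : Y →ₗ[R] Y) (tmul R 1 y) = 0 := by
      refine (hθ 0).1 (LinearMap.ext fun x => ?_)
      rw [hμ, map_zero]
      exact LinearMap.congr_fun hy (ε x)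
    have h2 := hY.map_injective (IsFP.of_free n) (hD 0) (coaug_injective hP.surjective hi)
      (h1.trans (map_zero _).symm)
    -- The action map recovers `y` from `1 ⊗ y`.
    let act : Tens R Rᵐᵒᵖ Y →+ Y := Tens.lift R
      { toFun := fun r => DistribSMul.toAddMonoidHom Y r.unop
        map_zero' := by ext; simp
        map_add' := fun q q' => by ext; simp [add_smul] }
      (fun r q m => by simp [mul_smul])
    have h3 : (1 : R) • y = 0 := (congrArg act h2).trans (map_zero act)
    rwa [one_smul] at h3
  · intro h
    -- The map `h ∘ ε` vanishes on boundaries, so the corresponding `t` comes from `Rᵐᵒᵖ ⊗ Y`, that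
    -- is, from some `1 ⊗ y`.
    obtain ⟨t, ht⟩ := (hθ 0).2 ((h : C →ₗ[S] Tens R C Y) ∘ₗ ε)
    have h1 : Tens.map R (LinearMap.lcomp Rᵐᵒᵖ C (d 0)) LinearMap.id t = 0 := by
      refine (hθ _).1 ((homTens_naturality (d 0) t).trans ?_)
      rw [ht, map_zero]
      refine LinearMap.ext fun x => ?_
      exact (congrArg h (hP.exact_zero.apply_apply_eq_zero x)).trans
        (LinearMap.map_zero (h : C →ₗ[S] Tens R C Y))
    obtain ⟨s, rfl⟩ := (hY.exact (coaug_exact hP hs) (hr _) (hD _) t).1 h1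
    obtain ⟨y, rfl⟩ := hone s
    refine ⟨y, LinearMap.ext fun c => ?_⟩
    obtain ⟨x, rfl⟩ := hP.surjective c
    exact (hμ y x).symm.trans (LinearMap.congr_fun ht x)

end Membership

/-! ### `Hom(P, -)` on short exact sequences -/

section HomShortExact

variable {A : Type u} [Ring A]

theorem exists_lift_of_exact {P N' N N'' : Type u} [AddCommGroup P] [Module A P]
    [AddCommGroup N'] [Module A N'] [AddCommGroup N] [Module A N] [AddCommGroup N'']
    [Module A N''] {f : N' →ₗ[A] N} {g : N →ₗ[A] N''} (hf : Function.Injective f)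
    (hfg : Function.Exact f g) (ψ : P →ₗ[A] N) (hψ : g ∘ₗ ψ = 0) : ∃ ω : P →ₗ[A] N', f ∘ₗ ω = ψ := by
  have hr : ∀ x, ψ x ∈ LinearMap.range f := fun x => (hfg _).1 (LinearMap.congr_fun hψ x)
  refine ⟨(LinearEquiv.ofInjective f hf).symm.toLinearMap ∘ₗ ψ.codRestrict _ hr,
    LinearMap.ext fun x => ?_⟩
  exact congrArg Subtype.val ((LinearEquiv.ofInjective f hf).apply_symm_apply ⟨ψ x, hr x⟩)

variable {C : ModuleCat.{u} A} {P : ℕ → ModuleCat.{u} A} {d : ∀ i, P (i + 1) →ₗ[A] P i}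
  {ε : P 0 →ₗ[A] C} {N' N N'' : Type u} [AddCommGroup N'] [Module A N'] [AddCommGroup N]
  [Module A N] [AddCommGroup N''] [Module A N''] {f : N' →ₗ[A] N} {g : N →ₗ[A] N''}

theorem IsLeftResolution.comp_eq_zero (h : IsLeftResolution P d ε) (i : ℕ) :
    d i ∘ₗ d (i + 1) = 0 :=
  (h.exact_succ i).linearMap_comp_eq_zero

theorem HomExact.of_equiv (h : HomExact P d N) (e : N ≃ₗ[A] N') : HomExact P d N' := by
  intro i φ hφ
  obtain ⟨ψ, hψ⟩ := h i (e.symm.toLinearMap ∘ₗ φ) (by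
    rw [LinearMap.comp_assoc, hφ, LinearMap.comp_zero])
  refine ⟨e.toLinearMap ∘ₗ ψ, ?_⟩
  rw [LinearMap.comp_assoc, hψ]
  ext x
  simp

/-- Lift the cocycle to `N`; its coboundary lies in `N'` and is a cocycle there, one degree up.
Exactness for `N'` corrects the lift to a cocycle in `N`. -/
theorem HomExact.cokernel (hP : ∀ i, Module.Projective A (P i)) (h : IsLeftResolution P d ε)
    (hf : Function.Injective f) (hfg : Function.Exact f g) (hg : Function.Surjective g)
    (h' : HomExact P d N') (hN : HomExact P d N) : HomExact P d N'' := by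
  intro i φ hφ
  have := hP (i + 1)
  obtain ⟨ψ, rfl⟩ := Module.projective_lifting_property g φ hg
  obtain ⟨χ, hχ⟩ := exists_lift_of_exact hf hfg (ψ ∘ₗ d (i + 1)) hφ
  obtain ⟨χ', rfl⟩ := h' (i + 1) χ (by
    refine LinearMap.cancel_left hf |>.1 ?_
    rw [← LinearMap.comp_assoc, hχ, LinearMap.comp_assoc, h.comp_eq_zero]; simp)
  obtain ⟨ψ', hψ'⟩ := hN i (ψ - f ∘ₗ χ') (by
    rw [LinearMap.sub_comp, LinearMap.comp_assoc, hχ, sub_self])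
  refine ⟨g ∘ₗ ψ', ?_⟩
  rw [LinearMap.comp_assoc, hψ', LinearMap.comp_sub, ← LinearMap.comp_assoc,
    hfg.linearMap_comp_eq_zero, LinearMap.zero_comp, sub_zero]

/-- The obstruction to lifting `χ` is a cocycle `ω` on `P 1` with values in `N'`; exactness makes it
a coboundary, which is subtracted. -/
theorem HomExact.exists_lift (hP : ∀ i, Module.Projective A (P i)) (h : IsLeftResolution P d ε)
    (hf : Function.Injective f) (hfg : Function.Exact f g) (hg : Function.Surjective g)
    (h' : HomExact P d N') (χ : C →ₗ[A] N'') : ∃ θ : C →ₗ[A] N, g ∘ₗ θ = χ := by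
  have := hP 0
  obtain ⟨ψ, hψ⟩ := Module.projective_lifting_property g (χ ∘ₗ ε) hg
  obtain ⟨ω, hω⟩ := exists_lift_of_exact hf hfg (ψ ∘ₗ d 0) (by
    rw [← LinearMap.comp_assoc, hψ, LinearMap.comp_assoc, h.exact_zero.linearMap_comp_eq_zero,
      LinearMap.comp_zero])
  obtain ⟨ω', rfl⟩ := h' 0 ω (by
    refine LinearMap.cancel_left hf |>.1 ?_
    rw [← LinearMap.comp_assoc, hω, LinearMap.comp_assoc, h.comp_eq_zero]; simp)
  obtain ⟨θ, hθ⟩ := exists_factor h.exact_zero h.surjective (ψ - f ∘ₗ ω') fun x => by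
    have := LinearMap.congr_fun hω x
    simp only [LinearMap.comp_apply] at this
    simp [this]
  refine ⟨θ, LinearMap.ext fun c => ?_⟩
  obtain ⟨x, rfl⟩ := h.surjective c
  have h1 : g (ψ x) = χ (ε x) := LinearMap.congr_fun hψ x
  have h2 : g (f (ω' x)) = 0 := hfg.apply_apply_eq_zero _
  simp [hθ, h1, h2]

/-- Bound `f ∘ φ` by some `ψ` in `N`. Then `g ∘ ψ` is a cocycle: in positive degree it is a
coboundary, in degree zero a map from `C`, which `hl` lifts. Subtracting a lift that is a cocycle
moves `ψ` into `N'`. -/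
theorem HomExact.kernel (hP : ∀ i, Module.Projective A (P i)) (h : IsLeftResolution P d ε)
    (hf : Function.Injective f) (hfg : Function.Exact f g) (hg : Function.Surjective g)
    (hN : HomExact P d N) (h'' : HomExact P d N'')
    (hl : ∀ χ : C →ₗ[A] N'', ∃ θ : C →ₗ[A] N, g ∘ₗ θ = χ) : HomExact P d N' := by
  intro i φ hφ
  obtain ⟨ψ, hψ⟩ := hN i (f ∘ₗ φ) (by rw [LinearMap.comp_assoc, hφ, LinearMap.comp_zero])
  have hz : (g ∘ₗ ψ) ∘ₗ d i = 0 := by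
    rw [LinearMap.comp_assoc, hψ, ← LinearMap.comp_assoc, hfg.linearMap_comp_eq_zero,
      LinearMap.zero_comp]
  have key : ∃ χ : P i →ₗ[A] N, g ∘ₗ χ = g ∘ₗ ψ ∧ χ ∘ₗ d i = 0 := by
    cases i with
    | zero =>
      obtain ⟨χ, hχ⟩ := exists_factor h.exact_zero h.surjective (g ∘ₗ ψ) (LinearMap.congr_fun hz)
      obtain ⟨θ, rfl⟩ := hl χ
      refine ⟨θ ∘ₗ ε, LinearMap.ext hχ, ?_⟩
      rw [LinearMap.comp_assoc, h.exact_zero.linearMap_comp_eq_zero, LinearMap.comp_zero]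
    | succ i =>
      obtain ⟨χ, hχ⟩ := h'' i _ hz
      have := hP i
      obtain ⟨θ, rfl⟩ := Module.projective_lifting_property g χ hg
      refine ⟨θ ∘ₗ d i, hχ, ?_⟩
      rw [LinearMap.comp_assoc, h.comp_eq_zero, LinearMap.comp_zero]
  obtain ⟨χ, hχ, hχ0⟩ := key
  obtain ⟨ω, hω⟩ := exists_lift_of_exact hf hfg (ψ - χ) (by
    rw [LinearMap.comp_sub, hχ, sub_self])
  refine ⟨ω, LinearMap.cancel_left hf |>.1 ?_⟩
  rw [← LinearMap.comp_assoc, hω, LinearMap.sub_comp, hχ0, sub_zero, hψ]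

end HomShortExact

/-! ### `Q ⊗ -` on short exact sequences -/

section TensShortExact

variable {R : Type u} [Ring R]

theorem Tens.map_map {K K' K'' M M' M'' : Type u}
    [AddCommGroup K] [Module Rᵐᵒᵖ K] [AddCommGroup M] [Module R M]
    [AddCommGroup K'] [Module Rᵐᵒᵖ K'] [AddCommGroup M'] [Module R M']
    [AddCommGroup K''] [Module Rᵐᵒᵖ K''] [AddCommGroup M''] [Module R M'']
    (f : K →ₗ[Rᵐᵒᵖ] K') (f' : K' →ₗ[Rᵐᵒᵖ] K'') (g : M →ₗ[R] M') (g' : M' →ₗ[R] M'')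
    (x : Tens R K M) : Tens.map R f' g' (Tens.map R f g x) = Tens.map R (f' ∘ₗ f) (g' ∘ₗ g) x := by
  rw [Tens.map_comp]; rfl

theorem Tens.map_comm {K K' M M' : Type u}
    [AddCommGroup K] [Module Rᵐᵒᵖ K] [AddCommGroup M] [Module R M]
    [AddCommGroup K'] [Module Rᵐᵒᵖ K'] [AddCommGroup M'] [Module R M']
    (f : K →ₗ[Rᵐᵒᵖ] K') (g : M →ₗ[R] M') (x : Tens R K M) :
    Tens.map R f LinearMap.id (Tens.map R LinearMap.id g x) =
      Tens.map R LinearMap.id g (Tens.map R f LinearMap.id x) := by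
  rw [Tens.map_map, Tens.map_map]; rfl

theorem Tens.map_id_apply {K M : Type u} [AddCommGroup K] [Module Rᵐᵒᵖ K] [AddCommGroup M]
    [Module R M] (x : Tens R K M) : Tens.map R LinearMap.id LinearMap.id x = x :=
  DFunLike.congr_fun (Tens.map_id R) x

theorem Tens.map_equiv_bijective (K : Type u) {M M' : Type u} [AddCommGroup K] [Module Rᵐᵒᵖ K]
    [AddCommGroup M] [Module R M] [AddCommGroup M'] [Module R M'] (e : M ≃ₗ[R] M') :
    Function.Bijective (Tens.map R (LinearMap.id : K →ₗ[Rᵐᵒᵖ] K) e.toLinearMap) := by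
  refine Function.bijective_iff_has_inverse.2 ⟨Tens.map R LinearMap.id e.symm.toLinearMap,
    fun x => ?_, fun x => ?_⟩
  · rw [Tens.map_map]; simp [Tens.map_id_apply]
  · rw [Tens.map_map]; simp [Tens.map_id_apply]

variable {C : ModuleCat.{u} Rᵐᵒᵖ} {Q : ℕ → ModuleCat.{u} Rᵐᵒᵖ}
  {d : ∀ i, Q (i + 1) →ₗ[Rᵐᵒᵖ] Q i} {ε : Q 0 →ₗ[Rᵐᵒᵖ] C} {M' M M'' : Type u} [AddCommGroup M']
  [Module R M'] [AddCommGroup M] [Module R M] [AddCommGroup M''] [Module R M'']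
  {f : M' →ₗ[R] M} {g : M →ₗ[R] M''}

theorem TensExact.of_equiv (h : TensExact Q d M) (e : M ≃ₗ[R] M') : TensExact Q d M' := by
  intro i x
  obtain ⟨x, rfl⟩ := (Tens.map_equiv_bijective _ e).2 x
  rw [Tens.map_comm]
  constructor
  · intro hx
    obtain ⟨y, rfl⟩ := (h i x).1 ((Tens.map_equiv_bijective _ e).1 (hx.trans (map_zero _).symm))
    exact ⟨_, Tens.map_comm _ _ y⟩
  · rintro ⟨y, hy⟩
    obtain ⟨y, rfl⟩ := (Tens.map_equiv_bijective _ e).2 y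
    rw [Tens.map_comm] at hy
    rw [(h i x).2 ⟨y, (Tens.map_equiv_bijective _ e).1 hy⟩, map_zero]

/-- The element `b` maps to a cycle over `M''`, hence to a boundary; subtracting a lift of that
boundary moves `b` into `Q (i + 1) ⊗ M'`. The injectivity of `Q i ⊗ f` then identifies its image
with `a`. -/
theorem TensExact.exists_preimage (hQ : ∀ i, Module.Projective Rᵐᵒᵖ (Q i) ∧
    Module.Finite Rᵐᵒᵖ (Q i)) (h : IsLeftResolution Q d ε) (hf : Function.Injective f)
    (hfg : Function.Exact f g) (hg : Function.Surjective g) (h'' : TensExact Q d M'') (i : ℕ)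
    (a : Tens R (Q i) M') (b : Tens R (Q (i + 1)) M)
    (hab : Tens.map R LinearMap.id f a = Tens.map R (d i) LinearMap.id b) :
    ∃ a', Tens.map R (d i) LinearMap.id a' = a := by
  have := (hQ i).1
  have := (hQ i).2
  obtain ⟨c, hc⟩ := (h'' i (Tens.map R LinearMap.id g b)).1 (by
    rw [Tens.map_comm, ← hab]
    exact (Tens.exact_right hfg hg).apply_apply_eq_zero a)
  obtain ⟨b', rfl⟩ := Tens.map_surjective (K := Q (i + 1 + 1)) (f := LinearMap.id)
    Function.surjective_id hg c
  obtain ⟨a', ha'⟩ := (Tens.exact_right (K := Q (i + 1)) hfg hg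
    (b - Tens.map R (d (i + 1)) LinearMap.id b')).1 (by
      rw [map_sub, ← hc, sub_eq_zero]; exact Tens.map_comm _ _ _)
  refine ⟨a', Tens.map_injective_of_projective (Q i) hf ?_⟩
  rw [← Tens.map_comm, ha', map_sub, Tens.map_map_eq_zero (h.exact_succ i), sub_zero, hab]

theorem TensExact.kernel (hQ : ∀ i, Module.Projective Rᵐᵒᵖ (Q i) ∧ Module.Finite Rᵐᵒᵖ (Q i))
    (h : IsLeftResolution Q d ε) (hf : Function.Injective f) (hfg : Function.Exact f g)
    (hg : Function.Surjective g) (hM : TensExact Q d M) (h'' : TensExact Q d M'') :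
    TensExact Q d M' := by
  intro i a
  constructor
  · intro ha
    obtain ⟨b, hb⟩ := (hM i (Tens.map R LinearMap.id f a)).1 (by rw [Tens.map_comm, ha, map_zero])
    exact TensExact.exists_preimage hQ h hf hfg hg h'' _ a b hb.symm
  · rintro ⟨b, rfl⟩
    exact Tens.map_map_eq_zero (h.exact_succ i) b

/-- This is the vanishing of the connecting map out of `Tor₁(C, M'')`, which `exists_preimage`
yields in degree zero. -/
theorem TensExact.map_injective (hQ : ∀ i, Module.Projective Rᵐᵒᵖ (Q i) ∧
    Module.Finite Rᵐᵒᵖ (Q i)) (h : IsLeftResolution Q d ε) (hf : Function.Injective f)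
    (hfg : Function.Exact f g) (hg : Function.Surjective g) (h'' : TensExact Q d M'') :
    Function.Injective (Tens.map R (LinearMap.id : C →ₗ[Rᵐᵒᵖ] C) f) := by
  rw [injective_iff_map_eq_zero]
  intro t ht
  obtain ⟨a, rfl⟩ := Tens.map_surjective (R := R) (M := M') (g := LinearMap.id)
    h.surjective Function.surjective_id t
  rw [← Tens.map_comm] at ht
  obtain ⟨b, hb⟩ := (Tens.exact_left h.exact_zero h.surjective _).1 ht
  obtain ⟨a, rfl⟩ := TensExact.exists_preimage hQ h hf hfg hg h'' _ a b hb.symm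
  exact Tens.map_map_eq_zero h.exact_zero a

theorem TensExact.cokernel (hQ : ∀ i, Module.Projective Rᵐᵒᵖ (Q i) ∧ Module.Finite Rᵐᵒᵖ (Q i))
    (h : IsLeftResolution Q d ε) (hf : Function.Injective f) (hfg : Function.Exact f g)
    (hg : Function.Surjective g) (h' : TensExact Q d M') (hM : TensExact Q d M)
    (hi : Function.Injective (Tens.map R (LinearMap.id : C →ₗ[Rᵐᵒᵖ] C) f)) :
    TensExact Q d M'' := by
  intro i x
  constructor
  · intro hx
    obtain ⟨b, rfl⟩ := Tens.map_surjective (K := Q (i + 1)) (f := LinearMap.id)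
      Function.surjective_id hg x
    erw [Tens.map_comm] at hx
    obtain ⟨a, ha⟩ := (Tens.exact_right (K := Q i) hfg hg _).1 hx
    -- Here `a` measures the failure of `b` to be a cycle. In degree zero its class in `C ⊗ M'` dies
    -- because `C ⊗ f` is injective; in higher degrees `a` is a cycle over `M'`.
    have key : ∃ a', Tens.map R (d i) LinearMap.id a' = a := by
      cases i with
      | zero =>
        refine (Tens.exact_left h.exact_zero h.surjective a).1 (hi ?_)
        rw [← Tens.map_comm, ha, Tens.map_map_eq_zero h.exact_zero, map_zero]
      | succ i =>
        have := (hQ i).1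
        have := (hQ i).2
        refine (h' i a).1 (Tens.map_injective_of_projective (Q i) hf ?_)
        rw [← Tens.map_comm, ha, Tens.map_map_eq_zero (h.exact_succ i), map_zero]
    obtain ⟨a', rfl⟩ := key
    obtain ⟨c, hc⟩ := (hM i (b - Tens.map R LinearMap.id f a')).1 (by
      rw [map_sub, ← ha, Tens.map_comm, sub_self])
    refine ⟨Tens.map R LinearMap.id g c, ?_⟩
    rw [Tens.map_comm, hc, map_sub, (Tens.exact_right hfg hg).apply_apply_eq_zero, sub_zero]
  · rintro ⟨b, rfl⟩
    exact Tens.map_map_eq_zero (h.exact_succ i) b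

end TensShortExact

/-! ### Linear forms of the two functors and naturality of `μ` and `ν` -/

section Functors

variable {R S : Type u} [Ring R] [Ring S] {C : Type u}
  [AddCommGroup C] [Module S C] [Module Rᵐᵒᵖ C] [SMulCommClass S Rᵐᵒᵖ C]

/-- The `S`-linear map `C ⊗ g : C ⊗_R M → C ⊗_R M'`. -/
def tensLin (S : Type u) [Ring S] (C : Type u) [AddCommGroup C] [Module S C] [Module Rᵐᵒᵖ C]
    [SMulCommClass S Rᵐᵒᵖ C] {M M' : Type u} [AddCommGroup M] [Module R M] [AddCommGroup M']
    [Module R M'] (g : M →ₗ[R] M') : Tens R C M →ₗ[S] Tens R C M' where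
  toFun := Tens.map R LinearMap.id g
  map_add' := map_add _
  map_smul' s x := by
    induction x using Tens.induction with
    | h0 => simp
    | ht k m => rfl
    | ha x y hx hy => rw [smul_add, map_add, hx, hy, map_add, smul_add]

/-- The `R`-linear map `Hom_S(C, g) : Hom_S(C, N) → Hom_S(C, N')`. -/
def homLin (R : Type u) [Ring R] {S : Type u} [Ring S] (C : Type u) [AddCommGroup C] [Module S C]
    [Module Rᵐᵒᵖ C] [SMulCommClass S Rᵐᵒᵖ C] {N N' : Type u} [AddCommGroup N] [Module S N]
    [AddCommGroup N'] [Module S N'] (g : N →ₗ[S] N') : HomMod S C N →ₗ[R] HomMod S C N' where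
  toFun f := g ∘ₗ (f : C →ₗ[S] N)
  map_add' f f' := LinearMap.ext fun c => map_add g (f c) (f' c)
  map_smul' _ _ := rfl

theorem HomMod.ext {N : Type u} [AddCommGroup N] [Module S N] {f g : HomMod S C N}
    (h : ∀ c, f c = g c) : f = g := LinearMap.ext h

/-- `C ⊗ e` as a linear equivalence. -/
def tensEquiv (S : Type u) [Ring S] (C : Type u) [AddCommGroup C] [Module S C] [Module Rᵐᵒᵖ C]
    [SMulCommClass S Rᵐᵒᵖ C] {M M' : Type u} [AddCommGroup M] [Module R M] [AddCommGroup M']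
    [Module R M'] (e : M ≃ₗ[R] M') : Tens R C M ≃ₗ[S] Tens R C M' :=
  LinearEquiv.ofBijective (tensLin S C e.toLinearMap) (Tens.map_equiv_bijective C e)

/-- `Hom_S(C, e)` as a linear equivalence. -/
def homEquiv (R : Type u) [Ring R] {S : Type u} [Ring S] (C : Type u) [AddCommGroup C] [Module S C]
    [Module Rᵐᵒᵖ C] [SMulCommClass S Rᵐᵒᵖ C] {N N' : Type u} [AddCommGroup N] [Module S N]
    [AddCommGroup N'] [Module S N'] (e : N ≃ₗ[S] N') : HomMod S C N ≃ₗ[R] HomMod S C N' :=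
  LinearEquiv.ofLinearMap (homLin R C e.toLinearMap) (homLin R C e.symm.toLinearMap)
    (LinearMap.ext fun f => HomMod.ext fun c => e.apply_symm_apply (f c))
    (LinearMap.ext fun f => HomMod.ext fun c => e.symm_apply_apply (f c))

theorem homLin_injective {N N' : Type u} [AddCommGroup N] [Module S N]
    [AddCommGroup N'] [Module S N'] {g : N →ₗ[S] N'} (hg : Function.Injective g) :
    Function.Injective (homLin R C g) := fun _ _ h =>
  HomMod.ext fun c => hg (DFunLike.congr_fun h c)

theorem homLin_exact {N' N N'' : Type u} [AddCommGroup N'] [Module S N'] [AddCommGroup N]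
    [Module S N] [AddCommGroup N''] [Module S N''] {f : N' →ₗ[S] N} {g : N →ₗ[S] N''}
    (hf : Function.Injective f) (hfg : Function.Exact f g) :
    Function.Exact (homLin R C f) (homLin R C g) := by
  intro φ
  constructor
  · exact exists_lift_of_exact hf hfg φ
  · rintro ⟨ψ, rfl⟩
    exact HomMod.ext fun c => hfg.apply_apply_eq_zero (ψ c)

theorem evalMu_naturality {M M' : ModuleCat.{u} R} (g : M →ₗ[R] M') (m : M) (c : C) :
    Tens.map R LinearMap.id g (evalMu R S C M m c) = evalMu R S C M' (g m) c := rfl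

theorem evalNu_naturality {N N' : ModuleCat.{u} S} (g : N →ₗ[S] N')
    (t : Tens R C (HomMod S C N)) :
    evalNu R S C N' (Tens.map R LinearMap.id (homLin R C g) t) = g (evalNu R S C N t) := by
  induction t using Tens.induction with
  | h0 => exact (map_zero _).trans ((congrArg g (map_zero (evalNu R S C N))).trans (map_zero g)).symm
  | ht k m => rfl
  | ha x y hx hy =>
    rw [map_add]
    refine (map_add _ _ _).trans ?_
    rw [hx, hy, ← map_add]
    exact congrArg g (map_add (evalNu R S C N) x y).symm

end Functors

/-! ### Closure properties of the Auslander and Bass classes -/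

section Classes

variable {R S : Type u} [Ring R] [Ring S] {C : Type u}
  [AddCommGroup C] [Module S C] [Module Rᵐᵒᵖ C] [SMulCommClass S Rᵐᵒᵖ C]

/-- The Auslander class is closed under kernels of epimorphisms. -/
theorem IsSemidualizing.auslanderClass_kernel (hC : IsSemidualizing R S C)
    {M' M M'' : ModuleCat.{u} R} {f : M' →ₗ[R] M} {g : M →ₗ[R] M''} (hf : Function.Injective f)
    (hfg : Function.Exact f g) (hg : Function.Surjective g) (hM : auslanderClass R S C M)
    (hM'' : auslanderClass R S C M'') :
    auslanderClass R S C M' ∧ Function.Injective (tensLin S C f) := by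
  obtain ⟨P, dP, εP, hP, hPp⟩ := hC.resolution_left
  obtain ⟨Q, dQ, εQ, hQ, hQp⟩ := hC.resolution_right
  have tM := (hQ.tor_iff (fun i => (hQp i).1) _).1 hM.tor_zero
  have tM'' := (hQ.tor_iff (fun i => (hQp i).1) _).1 hM''.tor_zero
  have eM := (hP.ext_iff (fun i => (hPp i).1) _).1 hM.ext_zero
  have eM'' := (hP.ext_iff (fun i => (hPp i).1) _).1 hM''.ext_zero
  have hinj : Function.Injective (tensLin S C f) :=
    TensExact.map_injective hQp hQ hf hfg hg tM''
  have hex : Function.Exact (tensLin S C f) (tensLin S C g) := Tens.exact_right hfg hg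
  have hsur : Function.Surjective (tensLin S C g) :=
    Tens.map_surjective (f := LinearMap.id) Function.surjective_id hg
  refine ⟨⟨(hQ.tor_iff (fun i => (hQp i).1) _).2 (TensExact.kernel hQp hQ hf hfg hg tM tM''),
    (hP.ext_iff (fun i => (hPp i).1) _).2 (HomExact.kernel (fun i => (hPp i).1) hP hinj hex hsur
      eM eM'' fun χ => ?_), ?_, ?_⟩, hinj⟩
  -- Every map `C → C ⊗ M''` is `c ↦ c ⊗ m''`, so lifting `m''` along `g` lifts the map.
  · obtain ⟨m'', hm⟩ := hM''.bijective.2 χ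
    obtain ⟨m, rfl⟩ := hg m''
    exact ⟨evalMu R S C M m, hm⟩
  · intro x y hxy
    refine hf (hM.bijective.1 (HomMod.ext fun c => ?_))
    rw [← evalMu_naturality, ← evalMu_naturality, hxy]
  · intro h
    obtain ⟨m, hm⟩ := hM.bijective.2 (homLin R C (tensLin S C f) h)
    have hgm : g m = 0 := by
      refine hM''.bijective.1 (HomMod.ext fun c => ?_)
      rw [← evalMu_naturality, hm, map_zero]
      exact hex.apply_apply_eq_zero (h c)
    obtain ⟨m', rfl⟩ := (hfg m).1 hgm
    refine ⟨m', homLin_injective (R := R) hinj ?_⟩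
    rw [← hm]
    exact HomMod.ext fun c => evalMu_naturality f m' c

/-- The Bass class is closed under cokernels of monomorphisms. -/
theorem IsSemidualizing.bassClass_cokernel (hC : IsSemidualizing R S C)
    {N' N N'' : ModuleCat.{u} S} {f : N' →ₗ[S] N} {g : N →ₗ[S] N''} (hf : Function.Injective f)
    (hfg : Function.Exact f g) (hg : Function.Surjective g) (hN' : bassClass R S C N')
    (hN : bassClass R S C N) :
    bassClass R S C N'' ∧ Function.Surjective (homLin R C g) := by
  obtain ⟨P, dP, εP, hP, hPp⟩ := hC.resolution_left
  obtain ⟨Q, dQ, εQ, hQ, hQp⟩ := hC.resolution_right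
  have tN' := (hQ.tor_iff (fun i => (hQp i).1) _).1 hN'.tor_zero
  have tN := (hQ.tor_iff (fun i => (hQp i).1) _).1 hN.tor_zero
  have eN' := (hP.ext_iff (fun i => (hPp i).1) _).1 hN'.ext_zero
  have eN := (hP.ext_iff (fun i => (hPp i).1) _).1 hN.ext_zero
  have hsur : Function.Surjective (homLin R C g) :=
    HomExact.exists_lift (fun i => (hPp i).1) hP hf hfg hg eN'
  have hinj := homLin_injective (R := R) (C := C) hf
  have hex := homLin_exact (R := R) (C := C) hf hfg
  -- Naturality of `ν` embeds this map into `f ∘ ν`, whose two factors are injective.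
  have hti : Function.Injective (Tens.map R (LinearMap.id : C →ₗ[Rᵐᵒᵖ] C) (homLin R C f)) := by
    intro x y hxy
    refine hN'.bijective.1 (hf ?_)
    rw [← evalNu_naturality, hxy, evalNu_naturality]
  refine ⟨⟨(hP.ext_iff (fun i => (hPp i).1) _).2
      (HomExact.cokernel (fun i => (hPp i).1) hP hf hfg hg eN' eN),
    (hQ.tor_iff (fun i => (hQp i).1) _).2 (TensExact.cokernel hQp hQ hinj hex hsur tN' tN hti),
    ?_, ?_⟩, hsur⟩
  · rw [injective_iff_map_eq_zero]
    intro t ht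
    obtain ⟨t, rfl⟩ := Tens.map_surjective (R := R) (K := C) (f := LinearMap.id)
      Function.surjective_id hsur t
    obtain ⟨n', hn'⟩ := (hfg (evalNu R S C N t)).1 ((evalNu_naturality g t).symm.trans ht)
    obtain ⟨t', rfl⟩ := hN'.bijective.2 n'
    have : t = Tens.map R LinearMap.id (homLin R C f) t' :=
      hN.bijective.1 (hn'.symm.trans (evalNu_naturality f t').symm)
    rw [this]
    exact (Tens.exact_right hex hsur).apply_apply_eq_zero t'
  · intro n
    obtain ⟨n, rfl⟩ := hg n
    obtain ⟨t, rfl⟩ := hN.bijective.2 n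
    exact ⟨_, evalNu_naturality g t⟩

theorem fpFlat.of_subsingleton (n : ℕ) (Y : ModuleCat.{u} R) [Subsingleton Y] : fpFlat n Y := by
  intro K L _ _ f _ x y _
  have h : ∀ x : Tens R K Y, x = 0 := fun x => by
    induction x using Tens.induction with
    | h0 => rfl
    | ht k m => rw [Subsingleton.elim m 0, tmul_zero]
    | ha x y hx hy => rw [hx, hy, add_zero]
  rw [h x, h y]

theorem fpInj.of_subsingleton (n : ℕ) (X : ModuleCat.{u} S) [Subsingleton X] : fpInj n X :=
  fun _ _ _ _ _ _ _ => ⟨0, LinearMap.ext fun _ => Subsingleton.elim _ _⟩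

/-- An isomorphism is a short exact sequence ending in the zero module, which is `fp_0`-flat, so
closure under kernels applies. -/
theorem IsSemidualizing.auslanderClass_of_equiv (hC : IsSemidualizing R S C)
    {M M' : ModuleCat.{u} R} (e : M ≃ₗ[R] M') (hM' : auslanderClass R S C M') :
    auslanderClass R S C M := by
  refine (hC.auslanderClass_kernel (M'' := ModuleCat.of R PUnit.{u + 1}) (f := e.toLinearMap)
    (g := 0) e.injective (fun x => ?_) (fun x => ⟨0, rfl⟩) hM'
    (hC.auslanderClass_of_fpFlat (fpFlat.of_subsingleton 0 _))).1
  exact ⟨fun _ => e.surjective x, fun _ => rfl⟩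

theorem IsSemidualizing.bassClass_of_equiv (hC : IsSemidualizing R S C)
    {N N' : ModuleCat.{u} S} (e : N ≃ₗ[S] N') (hN : bassClass R S C N) :
    bassClass R S C N' := by
  refine (hC.bassClass_cokernel (N' := ModuleCat.of S PUnit.{u + 1}) (f := 0)
    (g := e.toLinearMap) (fun x y _ => rfl) (fun x => ?_) e.surjective
    (hC.bassClass_of_fpInj (fpInj.of_subsingleton 0 _)) hN).1
  exact ⟨fun h => ⟨0, (e.injective (h.trans (map_zero e).symm)).symm⟩,
    by rintro ⟨y, rfl⟩; exact map_zero e⟩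

/-- By the triangle identity, `μ` at `Hom_S(C, X)` is inverse to `Hom_S(C, ν)`; the Ext condition is
carried along `ν`. -/
theorem IsSemidualizing.auslanderClass_homObj (hC : IsSemidualizing R S C) {X : ModuleCat.{u} S}
    (hX : bassClass R S C X) : auslanderClass R S C (homObj R S C X) := by
  obtain ⟨P, dP, εP, hP, hPp⟩ := hC.resolution_left
  have key : ∀ (h : HomMod S C X) (c : C), evalNu R S C X (evalMu R S C (homObj R S C X) h c) =
    h c := fun _ _ => rfl
  refine ⟨hX.tor_zero, (hP.ext_iff (fun i => (hPp i).1) _).2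
    (HomExact.of_equiv ((hP.ext_iff (fun i => (hPp i).1) _).1 hX.ext_zero)
      (LinearEquiv.ofBijective _ hX.bijective).symm), fun x y hxy => HomMod.ext fun c => ?_,
      fun h => ?_⟩
  · rw [← key, hxy, key]
  · refine ⟨homLin R C (evalNu R S C X) h, HomMod.ext fun c => hX.bijective.1 ?_⟩
    exact key _ c

/-- By the other triangle identity, `ν` at `C ⊗ Y` is inverse to `C ⊗ μ`; the Tor condition is
carried along `μ`. -/
theorem IsSemidualizing.bassClass_tensObj (hC : IsSemidualizing R S C) {Y : ModuleCat.{u} R}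
    (hY : auslanderClass R S C Y) : bassClass R S C (tensObj R S C Y) := by
  obtain ⟨Q, dQ, εQ, hQ, hQp⟩ := hC.resolution_right
  let e := LinearEquiv.ofBijective _ hY.bijective
  have hμ : Function.Bijective (Tens.map R (LinearMap.id : C →ₗ[Rᵐᵒᵖ] C) (evalMu R S C Y)) :=
    Tens.map_equiv_bijective C e
  have key : ∀ t : Tens R C Y,
      evalNu R S C (tensObj R S C Y) (Tens.map R LinearMap.id (evalMu R S C Y) t) = t := by
    intro t
    induction t using Tens.induction with
    | h0 => rw [map_zero]; exact map_zero _
    | ht k m => rfl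
    | ha x y hx hy =>
      rw [map_add]
      refine (map_add _ _ _).trans ?_
      rw [hx, hy]
  refine ⟨hY.ext_zero, (hQ.tor_iff (fun i => (hQp i).1) _).2
    (TensExact.of_equiv ((hQ.tor_iff (fun i => (hQp i).1) _).1 hY.tor_zero) e),
    fun x y hxy => ?_, fun t => ⟨_, key t⟩⟩
  obtain ⟨x, rfl⟩ := hμ.2 x
  obtain ⟨y, rfl⟩ := hμ.2 y
  rw [key, key] at hxy
  rw [hxy]

end Classes

/-! ### Splitting and splicing finite (co)resolutions -/

section Dimension

variable {R : Type u} [Ring R] {P : ObjectProperty (ModuleCat.{u} R)} {k : ℕ}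

theorem CoresDimLE.of_equiv {M N : ModuleCat.{u} R} (h : CoresDimLE P k N) (e : M ≃ₗ[R] N) :
    CoresDimLE P k M := by
  obtain ⟨I, d, η, h, hI⟩ := h
  refine ⟨I, d, η ∘ₗ e.toLinearMap, ⟨h.injective.comp e.injective, fun x => ?_, h.exact_succ⟩, hI⟩
  refine (h.exact_zero x).trans ⟨?_, ?_⟩
  · rintro ⟨y, rfl⟩
    exact ⟨e.symm y, congrArg η (e.apply_symm_apply y)⟩
  · rintro ⟨y, rfl⟩
    exact ⟨e y, rfl⟩

theorem ResDimLE.of_equiv {M N : ModuleCat.{u} R} (h : ResDimLE P k M) (e : M ≃ₗ[R] N) :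
    ResDimLE P k N := by
  obtain ⟨F, d, ε, h, hF⟩ := h
  refine ⟨F, d, e.toLinearMap ∘ₗ ε, ⟨e.surjective.comp h.surjective, fun x => ?_, h.exact_succ⟩,
    hF⟩
  exact Iff.trans ⟨fun hx => e.injective (hx.trans (map_zero e).symm),
    fun hx => (congrArg e hx).trans (map_zero e)⟩ (h.exact_zero x)

theorem CoresDimLE.exists_equiv {M : ModuleCat.{u} R} (h : CoresDimLE P 0 M) :
    ∃ I, P I ∧ Nonempty (M ≃ₗ[R] I) := by
  obtain ⟨I, d, η, h, hP, h0⟩ := h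
  have := h0 1 one_pos
  exact ⟨I 0, hP 0 le_rfl, ⟨LinearEquiv.ofBijective η ⟨h.injective, fun x =>
    (h.exact_zero x).1 (Subsingleton.elim _ _)⟩⟩⟩

theorem ResDimLE.exists_equiv {M : ModuleCat.{u} R} (h : ResDimLE P 0 M) :
    ∃ F, P F ∧ Nonempty (M ≃ₗ[R] F) := by
  obtain ⟨F, d, ε, h, hP, h0⟩ := h
  have := h0 1 one_pos
  refine ⟨F 0, hP 0 le_rfl, ⟨(LinearEquiv.ofBijective ε ⟨?_, h.surjective⟩).symm⟩⟩
  rw [injective_iff_map_eq_zero]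
  intro x hx
  obtain ⟨y, rfl⟩ := (h.exact_zero x).1 hx
  rw [Subsingleton.elim y 0, map_zero]

theorem CoresDimLE.zero {M : ModuleCat.{u} R} (h : P M) : CoresDimLE P 0 M := by
  refine ⟨consObj M fun _ => ModuleCat.of R PUnit.{u + 1}, fun _ => 0, LinearMap.id,
    ⟨Function.injective_id, fun x => ⟨fun _ => ⟨x, rfl⟩, fun _ => rfl⟩,
      fun i x => ⟨fun _ => ⟨0, rfl⟩, fun _ => rfl⟩⟩, ?_, ?_⟩
  · intro i hi
    obtain rfl := Nat.le_zero.1 hi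
    exact h
  · rintro (_ | i) hi
    · omega
    · exact inferInstanceAs (Subsingleton PUnit)

theorem ResDimLE.zero {M : ModuleCat.{u} R} (h : P M) : ResDimLE P 0 M := by
  refine ⟨consObj M fun _ => ModuleCat.of R PUnit.{u + 1}, fun _ => 0, LinearMap.id,
    ⟨Function.surjective_id, fun x => ⟨fun h => ⟨0, h.symm⟩, ?_⟩,
      fun i x => ⟨fun _ => ⟨0, rfl⟩, fun _ => rfl⟩⟩, ?_, ?_⟩
  · rintro ⟨y, rfl⟩
    rfl
  · intro i hi
    obtain rfl := Nat.le_zero.1 hi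
    exact h
  · rintro (_ | i) hi
    · omega
    · exact inferInstanceAs (Subsingleton PUnit)

/-- Cutting at the image of `d 0`; with the splicing in `CoresDimLE.succ` it reduces dimension `k`
to induction over short exact sequences. -/
theorem CoresDimLE.exists_shortExact {M : ModuleCat.{u} R} (h : CoresDimLE P (k + 1) M) :
    ∃ (I M' : ModuleCat.{u} R) (f : M →ₗ[R] I) (g : I →ₗ[R] M'), Function.Injective f ∧
      Function.Exact f g ∧ Function.Surjective g ∧ P I ∧ CoresDimLE P k M' := by
  obtain ⟨I, d, η, h, hP, h0⟩ := h
  refine ⟨I 0, ModuleCat.of R (LinearMap.range (d 0)), η, (d 0).rangeRestrict, h.injective,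
    fun x => Iff.trans (Subtype.ext_iff (a1 := (d 0).rangeRestrict x) (a2 := 0)) (h.exact_zero x),
    (d 0).surjective_rangeRestrict, hP 0 (Nat.zero_le _), fun i => I (i + 1), fun i => d (i + 1),
    (LinearMap.range (d 0)).subtype, ⟨Subtype.val_injective, fun x => ?_,
      fun i => h.exact_succ (i + 1)⟩, fun i hi => hP _ (by omega), fun i hi => h0 _ (by omega)⟩
  refine (h.exact_succ 0 x).trans ⟨fun hx => ⟨⟨x, hx⟩, rfl⟩, ?_⟩
  rintro ⟨y, rfl⟩
  exact y.2

theorem ResDimLE.exists_shortExact {M : ModuleCat.{u} R} (h : ResDimLE P (k + 1) M) :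
    ∃ (F M' : ModuleCat.{u} R) (f : M' →ₗ[R] F) (g : F →ₗ[R] M), Function.Injective f ∧
      Function.Exact f g ∧ Function.Surjective g ∧ P F ∧ ResDimLE P k M' := by
  obtain ⟨F, d, ε, h, hP, h0⟩ := h
  have hm : ∀ x, d 0 x ∈ LinearMap.ker ε := fun x => h.exact_zero.apply_apply_eq_zero x
  refine ⟨F 0, ModuleCat.of R (LinearMap.ker ε), (LinearMap.ker ε).subtype, ε,
    Subtype.val_injective, LinearMap.exact_subtype_ker_map ε, h.surjective, hP 0 (Nat.zero_le _),
    fun i => F (i + 1), fun i => d (i + 1), (d 0).codRestrict _ hm, ⟨?_, fun x => ?_,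
      fun i => h.exact_succ (i + 1)⟩, fun i hi => hP _ (by omega), fun i hi => h0 _ (by omega)⟩
  · rintro ⟨x, hx⟩
    obtain ⟨y, hy⟩ := (h.exact_zero x).1 hx
    exact ⟨y, Subtype.ext hy⟩
  · exact Iff.trans (Subtype.ext_iff (a1 := (d 0).codRestrict _ hm x) (a2 := 0))
      (h.exact_succ 0 x)

/-- The sequence of maps `e, d 0, d 1, …` of increasing degree. -/
def consComap {G : ModuleCat.{u} R} {F : ℕ → ModuleCat.{u} R} (d : ∀ i, F i →ₗ[R] F (i + 1))
    (e : G →ₗ[R] F 0) : ∀ i, consObj G F i →ₗ[R] consObj G F (i + 1)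
  | 0 => e
  | i + 1 => d i

theorem CoresDimLE.succ {M I M' : ModuleCat.{u} R} {f : M →ₗ[R] I} {g : I →ₗ[R] M'}
    (hf : Function.Injective f) (hfg : Function.Exact f g) (hg : Function.Surjective g) (hI : P I)
    (h : CoresDimLE P k M') : CoresDimLE P (k + 1) M := by
  obtain ⟨J, d, η, h, hP, h0⟩ := h
  refine ⟨consObj I J, consComap d (η ∘ₗ g), f, ⟨hf, fun x => ?_, ?_⟩, ?_, ?_⟩
  · exact Iff.trans ⟨fun hx => h.injective (hx.trans (map_zero η).symm),
      fun hx => (congrArg η hx).trans (map_zero η)⟩ (hfg x)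
  · rintro (_ | i)
    · intro x
      refine (h.exact_zero x).trans ⟨?_, ?_⟩
      · rintro ⟨y, rfl⟩
        obtain ⟨z, rfl⟩ := hg y
        exact ⟨z, rfl⟩
      · rintro ⟨z, rfl⟩
        exact ⟨g z, rfl⟩
    · exact h.exact_succ i
  · rintro (_ | i) hi
    · exact hI
    · exact hP i (by omega)
  · rintro (_ | i) hi
    · omega
    · exact h0 i (by omega)

theorem ResDimLE.succ {M F M' : ModuleCat.{u} R} {f : M' →ₗ[R] F} {g : F →ₗ[R] M}
    (hf : Function.Injective f) (hfg : Function.Exact f g) (hg : Function.Surjective g) (hF : P F)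
    (h : ResDimLE P k M') : ResDimLE P (k + 1) M := by
  obtain ⟨G, d, ε, h, hP, h0⟩ := h
  refine ⟨consObj F G, consMap d (f ∘ₗ ε), g, ⟨hg, fun x => ?_, ?_⟩, ?_, ?_⟩
  · refine (hfg x).trans ⟨?_, ?_⟩
    · rintro ⟨y, rfl⟩
      obtain ⟨z, rfl⟩ := h.surjective y
      exact ⟨z, rfl⟩
    · rintro ⟨z, rfl⟩
      exact ⟨ε z, rfl⟩
  · rintro (_ | i)
    · intro x
      exact Iff.trans ⟨fun hx => hf (hx.trans (map_zero f).symm),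
        fun hx => (congrArg f hx).trans (map_zero f)⟩ (h.exact_zero x)
    · exact h.exact_succ i
  · rintro (_ | i) hi
    · exact hF
    · exact hP i (by omega)
  · rintro (_ | i) hi
    · omega
    · exact h0 i (by omega)

theorem fpInj.of_equiv {n : ℕ} {X Y : ModuleCat.{u} R} (h : fpInj n X) (e : X ≃ₗ[R] Y) :
    fpInj n Y := by
  intro K L hK hL f hf φ
  obtain ⟨ψ, hψ⟩ := h K L hK hL f hf (e.symm.toLinearMap ∘ₗ φ)
  refine ⟨e.toLinearMap ∘ₗ ψ, LinearMap.ext fun x => ?_⟩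
  have h1 : ψ (f x) = e.symm (φ x) := LinearMap.congr_fun hψ x
  exact (congrArg e h1).trans (e.apply_symm_apply _)

theorem fpFlat.of_equiv {n : ℕ} {X Y : ModuleCat.{u} R} (h : fpFlat n X) (e : X ≃ₗ[R] Y) :
    fpFlat n Y := by
  intro K L hK hL f hf x y hxy
  obtain ⟨x, rfl⟩ := (Tens.map_equiv_bijective _ e).2 x
  obtain ⟨y, rfl⟩ := (Tens.map_equiv_bijective _ e).2 y
  rw [Tens.map_comm, Tens.map_comm] at hxy
  rw [h K L hK hL f hf ((Tens.map_equiv_bijective _ e).1 hxy)]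

end Dimension

/-! ### Transfer of dimensions through `C ⊗ -` and `Hom_S(C, -)` -/

section Equivalence

variable {R S : Type u} [Ring R] [Ring S] {C : Type u}
  [AddCommGroup C] [Module S C] [Module Rᵐᵒᵖ C] [SMulCommClass S Rᵐᵒᵖ C]

/-- If `M ≅ Hom_S(C, X)`, then `ν` gives `C ⊗ M ≅ X`, as `X` is in the Bass class. -/
theorem IsSemidualizing.of_CfpInj (hC : IsSemidualizing R S C) {n : ℕ} {M : ModuleCat.{u} R}
    (hM : CfpInj R S C n M) : auslanderClass R S C M ∧ fpInj n (tensObj R S C M) := by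
  obtain ⟨X, hX, ⟨e⟩⟩ := hM
  have hB := hC.bassClass_of_fpInj hX
  exact ⟨hC.auslanderClass_of_equiv e (hC.auslanderClass_homObj hB),
    hX.of_equiv ((tensEquiv S C e).trans (LinearEquiv.ofBijective _ hB.bijective)).symm⟩

theorem IsSemidualizing.of_CfpFlat (hC : IsSemidualizing R S C) {n : ℕ} {N : ModuleCat.{u} S}
    (hN : CfpFlat R S C n N) : bassClass R S C N ∧ fpFlat n (homObj R S C N) := by
  obtain ⟨Y, hY, ⟨e⟩⟩ := hN
  have hA := hC.auslanderClass_of_fpFlat hY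
  exact ⟨hC.bassClass_of_equiv e.symm (hC.bassClass_tensObj hA),
    hY.of_equiv ((LinearEquiv.ofBijective _ hA.bijective).trans (homEquiv R C e.symm))⟩

/-- The closure lemma yields membership and also the injectivity of `C ⊗ f`, so the tensored short
sequence can be spliced. -/
theorem IsSemidualizing.of_coresDimLE (hC : IsSemidualizing R S C) {n k : ℕ}
    {M : ModuleCat.{u} R} (hM : CoresDimLE (CfpInj R S C n) k M) :
    auslanderClass R S C M ∧ CoresDimLE (fpInj n) k (tensObj R S C M) := by
  induction k generalizing M with
  | zero =>
    obtain ⟨I, hI, ⟨e⟩⟩ := hM.exists_equiv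
    obtain ⟨hA, hX⟩ := hC.of_CfpInj hI
    exact ⟨hC.auslanderClass_of_equiv e hA, (CoresDimLE.zero hX).of_equiv (tensEquiv S C e)⟩
  | succ k ih =>
    obtain ⟨I, M', f, g, hf, hfg, hg, hI, hM'⟩ := hM.exists_shortExact
    obtain ⟨hA, hX⟩ := hC.of_CfpInj hI
    obtain ⟨hA', hX'⟩ := ih hM'
    obtain ⟨hA'', hinj⟩ := hC.auslanderClass_kernel hf hfg hg hA hA'
    exact ⟨hA'', CoresDimLE.succ (f := tensLin S C f) (g := tensLin S C g) hinj
      (Tens.exact_right hfg hg) (Tens.map_surjective (f := LinearMap.id) Function.surjective_id hg)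
      hX hX'⟩

theorem IsSemidualizing.of_resDimLE (hC : IsSemidualizing R S C) {n k : ℕ}
    {N : ModuleCat.{u} S} (hN : ResDimLE (CfpFlat R S C n) k N) :
    bassClass R S C N ∧ ResDimLE (fpFlat n) k (homObj R S C N) := by
  induction k generalizing N with
  | zero =>
    obtain ⟨F, hF, ⟨e⟩⟩ := hN.exists_equiv
    obtain ⟨hB, hY⟩ := hC.of_CfpFlat hF
    exact ⟨hC.bassClass_of_equiv e.symm hB, (ResDimLE.zero hY).of_equiv (homEquiv R C e.symm)⟩
  | succ k ih =>
    obtain ⟨F, N', f, g, hf, hfg, hg, hF, hN'⟩ := hN.exists_shortExact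
    obtain ⟨hB, hY⟩ := hC.of_CfpFlat hF
    obtain ⟨hB', hY'⟩ := ih hN'
    obtain ⟨hB'', hsur⟩ := hC.bassClass_cokernel hf hfg hg hB' hB
    exact ⟨hB'', ResDimLE.succ (f := homLin R C f) (g := homLin R C g) (homLin_injective hf)
      (homLin_exact hf hfg) hsur hY hY'⟩

/-- Only Ext vanishing is assumed of `X`, because exactly this passes to the cosyzygy `X'`; it also
makes `Hom_S(C, g)` surjective. -/
theorem IsSemidualizing.coresDimLE_homObj (hC : IsSemidualizing R S C) {n k : ℕ}
    {X : ModuleCat.{u} S}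
    (he : ∀ i : ℕ, 1 ≤ i → Subsingleton (Abelian.Ext.{u} (ModuleCat.of S C) X i))
    (hX : CoresDimLE (fpInj n) k X) : CoresDimLE (CfpInj R S C n) k (homObj R S C X) := by
  obtain ⟨P, dP, εP, hP, hPp⟩ := hC.resolution_left
  rw [hP.ext_iff fun i => (hPp i).1] at he
  induction k generalizing X with
  | zero =>
    obtain ⟨I, hI, ⟨e⟩⟩ := hX.exists_equiv
    exact CoresDimLE.zero ⟨I, hI, ⟨homEquiv R C e⟩⟩
  | succ k ih =>
    obtain ⟨I, X', f, g, hf, hfg, hg, hI, hX'⟩ := hX.exists_shortExact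
    have eI := homExact_of_fpInj hP hPp hI
    have hsur : Function.Surjective (homLin R C g) :=
      HomExact.exists_lift (fun i => (hPp i).1) hP hf hfg hg he
    exact CoresDimLE.succ (f := homLin R C f) (g := homLin R C g) (homLin_injective hf)
      (homLin_exact hf hfg) hsur ⟨I, hI, ⟨LinearEquiv.refl _ _⟩⟩
      (ih hX' (HomExact.cokernel (fun i => (hPp i).1) hP hf hfg hg he eI))

/-- Tor vanishing for `Y` makes `C ⊗ f` injective and passes to the syzygy `Y'`, since the flat term
is Tor-acyclic as well. -/
theorem IsSemidualizing.resDimLE_tensObj (hC : IsSemidualizing R S C) {n k : ℕ}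
    {Y : ModuleCat.{u} R}
    (ht : ∀ i : ℕ, 1 ≤ i → Limits.IsZero (TorGrp R i (ModuleCat.of Rᵐᵒᵖ C) Y))
    (hY : ResDimLE (fpFlat n) k Y) : ResDimLE (CfpFlat R S C n) k (tensObj R S C Y) := by
  obtain ⟨Q, dQ, εQ, hQ, hQp⟩ := hC.resolution_right
  rw [hQ.tor_iff fun i => (hQp i).1] at ht
  induction k generalizing Y with
  | zero =>
    obtain ⟨F, hF, ⟨e⟩⟩ := hY.exists_equiv
    exact ResDimLE.zero ⟨F, hF, ⟨tensEquiv S C e⟩⟩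
  | succ k ih =>
    obtain ⟨F, Y', f, g, hf, hfg, hg, hF, hY'⟩ := hY.exists_shortExact
    have tF := tensExact_of_fpFlat hQ hQp hF
    exact ResDimLE.succ (f := tensLin S C f) (g := tensLin S C g)
      (TensExact.map_injective hQp hQ hf hfg hg ht) (Tens.exact_right hfg hg)
      (Tens.map_surjective (f := LinearMap.id) Function.surjective_id hg)
      ⟨F, hF, ⟨LinearEquiv.refl _ _⟩⟩ (ih hY' (TensExact.kernel hQp hQ hf hfg hg tF ht))

end Equivalence

end SemiDual

end

theorem corollary4p6 {R S : Type u} [Ring R] [Ring S] (C : Type u) [AddCommGroup C]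
    [Module S C] [Module Rᵐᵒᵖ C] [SMulCommClass S Rᵐᵒᵖ C]
    (hC : SemiDual.IsFaithfullySemidualizing R S C) (n k : ℕ) (hn : 1 ≤ n)
    (M : ModuleCat.{u} R) (N : ModuleCat.{u} S) :
    (SemiDual.CoresDimLE (SemiDual.CfpInj R S C n) k M ↔
      SemiDual.auslanderClass R S C M ∧
        SemiDual.CoresDimLE (SemiDual.fpInj n) k (SemiDual.tensObj R S C M)) ∧
    (SemiDual.ResDimLE (SemiDual.CfpFlat R S C n) k N ↔
      SemiDual.bassClass R S C N ∧
        SemiDual.ResDimLE (SemiDual.fpFlat n) k (SemiDual.homObj R S C N)) := by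
  have hC' := hC.toIsSemidualizing
  refine ⟨⟨hC'.of_coresDimLE, fun ⟨hA, hX⟩ => ?_⟩, ⟨hC'.of_resDimLE, fun ⟨hB, hY⟩ => ?_⟩⟩
  -- The coresolution obtained is one of `Hom_S(C, C ⊗ M)`, which `μ` identifies with `M`.
  · exact (hC'.coresDimLE_homObj hA.ext_zero hX).of_equiv
      (LinearEquiv.ofBijective _ hA.bijective)
  · exact (hC'.resDimLE_tensObj hB.tor_zero hY).of_equiv
      (LinearEquiv.ofBijective _ hB.bijective)
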